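/- Let $(M,g)$ be a compact smooth Riemannian manifold of dimension $n$ without boundary. For a vector field $u$ write $\nabla u$ for its covariant derivative (Levi-Civita connection), viewed as a map $T_pM\to T_pM$, and put $S_u=\nabla u+(\nabla u)^*$ and $C_u=S_u-\frac2n\,\mathrm{div}(u)\,\mathrm{id}$, where $\mathrm{div}(u)=\mathrm{tr}(\nabla u)$. For $(1,1)$ tensors put $g(A,B)=\mathrm{tr}(AB^*)$. Let $\|u\|_{L^2}^2=\int_M g(u,u)\,\omega_M$ and $\|u\|_{H^1}^2=\int_M\big(g(u,u)+g(\nabla u,\nabla u)\big)\,\omega_M$, where $\omega_M$ is the Riemannian measure, and let $H^1(M)$ be the completion of the smooth vector fields for $\|\cdot\|_{H^1}$ (realised in $L^2$ through the weak covariant derivative). On $H^1(M)$ consider $$a_K(u,v)=\tfrac12\int_M g(S_u,S_v)\,\omega_M,\qquad a_C(u,v)=\tfrac12\int_M g(C_u,C_v)\,\omega_M .$$ A form $a$ on $H^1(M)$ is called coercive if there are constants $\alpha>0$ and $\mu\in\mathbb R$ with $a(v,v)+\mu\|v\|_{L^2}^2\ge\alpha\|v\|_{H^1}^2$ for all $v\in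 H^1(M)$. Then $a_K$ is coercive, and $a_C$ is coercive if $n\ge 2$. More precisely, let $\mathrm{Ri}$ be the Ricci tensor, viewed as a map $T_pM\to T_pM$. Its operator norm $\|\mathrm{Ri}\|$ is bounded on $M$, and $a_K(u,u)\ge a_C(u,u)$ for all $u\in H^1(M)$. Whenever $\mu\ge\|\mathrm{Ri}\|$ everywhere on $M$ and $0<\alpha\le 1$, every $u\in H^1(M)$ satisfies $$a_K(u,u)\ \ge\ \alpha\|u\|_{H^1}^2-(\mu+\alpha)\|u\|_{L^2}^2,$$ and, if $n\ge2$, also $$a_C(u,u)\ \ge\ \alpha\|u\|_{H^1}^2-(\mu+\alpha)\|u\|_{L^2}^2 .$$ Finally, if $\mathrm{Ri}$ is negative definite at every point, then every Killing field (smooth $u$ with $S_u=0$) vanishes identically, and, if $n\ge2$, so does every conformal Killing field (smooth $u$ with $C_u=0$). -/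

import Mathlib

open Bundle MeasureTheory Filter Topology
open scoped Manifold ContDiff Bundle

noncomputable section

namespace RiemannianKorn

/-- The model space `ℝⁿ`. -/
abbrev Model (n : ℕ) : Type := EuclideanSpace ℝ (Fin n)

/-- The standard basis of `ℝⁿ`. -/
def stdBasis (n : ℕ) : Module.Basis (Fin n) ℝ (Model n) :=
  (EuclideanSpace.basisFun (Fin n) ℝ).toBasis

/-- The `i`-th partial derivative of a real function on `ℝⁿ`. -/
def partialDeriv {n : ℕ} (i : Fin n) (f : Model n → ℝ) (y : Model n) : ℝ :=
  fderiv ℝ f y (stdBasis n i)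

/-! ### Vector fields and coordinates

`M` is a smooth manifold without boundary, modelled on `ℝⁿ`.  Coordinate expressions are
functions on `ℝⁿ`, meaningful on the image of the chart. -/

section Coordinates

variable {n : ℕ} {M : Type*} [TopologicalSpace M] [ChartedSpace (Model n) M]
  [IsManifold (𝓡 n) ∞ M]

/-- A vector field is smooth if it is smooth as a section of the tangent bundle. -/
def IsSmoothField (u : ∀ x : M, TangentSpace (𝓡 n) x) : Prop :=
  ContMDiff (𝓡 n) ((𝓡 n).prod 𝓘(ℝ, Model n)) ∞
    (fun x => (⟨x, u x⟩ : TangentBundle (𝓡 n) M))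

/-- The coordinate vector field `∂ᵢ` of the preferred chart at `p`, on the domain of the chart. -/
def coordField (p : M) (i : Fin n) (x : M) : TangentSpace (𝓡 n) x :=
  (trivializationAt (Model n) (TangentSpace (𝓡 n)) p).localFrame (stdBasis n) i x

/-- The `i`-th component of a tangent vector at `x`, with respect to the chart at `p`. -/
def coordComp (p : M) (i : Fin n) (x : M) (v : TangentSpace (𝓡 n) x) : ℝ :=
  (trivializationAt (Model n) (TangentSpace (𝓡 n)) p).localFrameCoeff (𝓡 n) (stdBasis n) i x v

/-- The basis `∂₁, …, ∂ₙ` of the tangent space at `x` given by the chart at `x`. -/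
def tangentBasis (x : M) : Module.Basis (Fin n) ℝ (TangentSpace (𝓡 n) x) :=
  (trivializationAt (Model n) (TangentSpace (𝓡 n)) x).basisAt (stdBasis n)
    (FiberBundle.mem_baseSet_trivializationAt' x)

instance instFiniteDimensionalTangent (x : M) : FiniteDimensional ℝ (TangentSpace (𝓡 n) x) :=
  Module.Basis.finiteDimensional_of_finite (tangentBasis x)

/-- The point of `M` with coordinates `y` in the chart at `p`. -/
def chartPoint (p : M) (y : Model n) : M := (extChartAt (𝓡 n) p).symm y

/-- The component function `uⁱ` of a vector field in the chart at `p`. -/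
def fieldCoord (u : ∀ x : M, TangentSpace (𝓡 n) x) (p : M) (i : Fin n) (y : Model n) : ℝ :=
  coordComp p i (chartPoint p y) (u (chartPoint p y))

end Coordinates

section Riemannian

variable {n : ℕ} {M : Type*} [TopologicalSpace M] [ChartedSpace (Model n) M]
  [IsManifold (𝓡 n) ∞ M] [RiemannianBundle (fun x : M => TangentSpace (𝓡 n) x)]

/-! ### The Levi-Civita connection and the Ricci tensor -/

/-- The matrix `gᵢⱼ` of the metric in the chart at `p`. -/
def metricCoord (p : M) (y : Model n) : Matrix (Fin n) (Fin n) ℝ :=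
  Matrix.of fun i j =>
    inner ℝ (coordField p i (chartPoint p y)) (coordField p j (chartPoint p y))

/-- The Christoffel symbol `Γᵏᵢⱼ = ½ gᵏˡ (∂ᵢ gⱼₗ + ∂ⱼ gᵢₗ - ∂ₗ gᵢⱼ)` in the chart at `p`. -/
def christoffel (p : M) (k i j : Fin n) (y : Model n) : ℝ :=
  (1 / 2 : ℝ) * ∑ l, (metricCoord p y)⁻¹ k l *
    (partialDeriv i (fun z => metricCoord p z j l) y
      + partialDeriv j (fun z => metricCoord p z i l) y
      - partialDeriv l (fun z => metricCoord p z i j) y)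

/-- The matrix `uᵏ_{;j} = ∂ⱼ uᵏ + Γᵏᵢⱼ uⁱ` (row `k`, column `j`) in the chart at `p`. -/
def covDerivCoord (u : ∀ x : M, TangentSpace (𝓡 n) x) (p : M) (y : Model n) :
    Matrix (Fin n) (Fin n) ℝ :=
  Matrix.of fun k j =>
    partialDeriv j (fieldCoord u p k) y + ∑ i, christoffel p k i j y * fieldCoord u p i y

/-- The covariant derivative `∇u` at `x`, the linear map `w ↦ ∇_w u`, computed in the chart
at `x`. -/
def covDeriv (u : ∀ x : M, TangentSpace (𝓡 n) x) (x : M) :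
    TangentSpace (𝓡 n) x →ₗ[ℝ] TangentSpace (𝓡 n) x :=
  Matrix.toLin (tangentBasis x) (tangentBasis x) (covDerivCoord u x (extChartAt (𝓡 n) x x))

/-- The matrix `Riⱼₖ = Rⁱᵢⱼₖ` of the Ricci tensor in the chart at `p`, where
`R(∂ᵢ, ∂ⱼ)∂ₖ = Rˡᵢⱼₖ ∂ₗ` (so that round spheres have positive Ricci tensor). -/
def ricciCoord (p : M) (y : Model n) : Matrix (Fin n) (Fin n) ℝ :=
  Matrix.of fun j k => ∑ i,
    (partialDeriv i (christoffel p i j k) y - partialDeriv j (christoffel p i i k) y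
      + ∑ l, (christoffel p i i l y * christoffel p l j k y
        - christoffel p i j l y * christoffel p l i k y))

/-- The Ricci tensor as a map `T_xM → T_xM`, with matrix `gⁱʲ Riⱼₖ`, computed in the chart
at `x`. -/
def ricci (x : M) : TangentSpace (𝓡 n) x →L[ℝ] TangentSpace (𝓡 n) x :=
  LinearMap.toContinuousLinearMap
    (Matrix.toLin (tangentBasis x) (tangentBasis x)
      ((metricCoord x (extChartAt (𝓡 n) x x))⁻¹ * ricciCoord x (extChartAt (𝓡 n) x x)))

/-- The Ricci tensor is negative definite at every point. -/
def RicciNegDef (n : ℕ) (M : Type*) [TopologicalSpace M] [ChartedSpace (Model n) M]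
    [IsManifold (𝓡 n) ∞ M] [RiemannianBundle (fun x : M => TangentSpace (𝓡 n) x)] : Prop :=
  ∀ (x : M) (v : TangentSpace (𝓡 n) x), v ≠ 0 → inner ℝ (ricci x v) v < 0

/-! ### Pointwise algebra of `(1,1)` tensors -/

/-- The inner product `g(A, B) = tr (A B*)` of `(1,1)` tensors at a point. -/
def tensorInner {x : M} (A B : TangentSpace (𝓡 n) x →ₗ[ℝ] TangentSpace (𝓡 n) x) : ℝ :=
  LinearMap.trace ℝ _ (A ∘ₗ LinearMap.adjoint B)

/-- The Killing operator in terms of `A = ∇u`:  `S_u = ∇u + (∇u)*`. -/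
def killingOp {x : M} (A : TangentSpace (𝓡 n) x →ₗ[ℝ] TangentSpace (𝓡 n) x) :
    TangentSpace (𝓡 n) x →ₗ[ℝ] TangentSpace (𝓡 n) x :=
  A + LinearMap.adjoint A

/-- The conformal Killing operator in terms of `A = ∇u`:  `C_u = S_u - (2/n) div(u) id`, where
`div(u) = tr (∇u)`. -/
def conformalOp {x : M} (A : TangentSpace (𝓡 n) x →ₗ[ℝ] TangentSpace (𝓡 n) x) :
    TangentSpace (𝓡 n) x →ₗ[ℝ] TangentSpace (𝓡 n) x :=
  killingOp A - ((2 / (n : ℝ)) * LinearMap.trace ℝ _ A) • LinearMap.id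

/-- A Killing field: a smooth vector field `u` with `Su = 0`. -/
def IsKilling (u : ∀ x : M, TangentSpace (𝓡 n) x) : Prop :=
  IsSmoothField u ∧ ∀ x, killingOp (covDeriv u x) = 0

/-- A conformal Killing field: a smooth vector field `u` with `Cu = 0`. -/
def IsConformalKilling (u : ∀ x : M, TangentSpace (𝓡 n) x) : Prop :=
  IsSmoothField u ∧ ∀ x, conformalOp (covDeriv u x) = 0

/-! ### The Riemannian measure -/

/-- The part of the Riemannian measure that is carried by the domain of the chart at `p`: the image
of `√(det g) dy` under the inverse of the chart. -/
def chartMeasure [MeasurableSpace M] (p : M) : Measure M :=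
  Measure.map (chartPoint p)
    ((volume.restrict (extChartAt (𝓡 n) p).target).withDensity
      fun y => ENNReal.ofReal (Real.sqrt (metricCoord p y).det))

/-- The Riemannian measure (density) of `M`.  The measures `chartMeasure p` agree on the
overlaps of the charts, so that their supremum is the measure which restricts to each of them. -/
def riemannianMeasure (n : ℕ) (M : Type*) [TopologicalSpace M] [ChartedSpace (Model n) M]
    [IsManifold (𝓡 n) ∞ M] [RiemannianBundle (fun x : M => TangentSpace (𝓡 n) x)]
    [MeasurableSpace M] : Measure M :=
  ⨆ p : M, chartMeasure (n := n) p

/-! ### The Sobolev space `H¹` of vector fields -/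

/-- An element of `H¹(M)`, the completion of the smooth vector fields for the `H¹` norm, realised
inside `L²`: a measurable vector field `u` together with its weak covariant derivative `∇u`, a
measurable `(1,1)` tensor field, such that there are smooth vector fields `φ₀, φ₁, …` with
`φₖ → u` and `∇φₖ → ∇u` in `L²`.  Measurability is that of all components in charts. -/
structure H1Field (n : ℕ) (M : Type*) [TopologicalSpace M] [ChartedSpace (Model n) M]
    [IsManifold (𝓡 n) ∞ M] [RiemannianBundle (fun x : M => TangentSpace (𝓡 n) x)]
    [MeasurableSpace M] where
  /-- the vector field `u` -/
  field : ∀ x : M, TangentSpace (𝓡 n) x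
  /-- its weak covariant derivative `∇u` -/
  cov : ∀ x : M, TangentSpace (𝓡 n) x →ₗ[ℝ] TangentSpace (𝓡 n) x
  aemeasurable_field : ∀ (p : M) (i : Fin n),
    AEMeasurable (fun x => coordComp p i x (field x)) (riemannianMeasure n M)
  aemeasurable_cov : ∀ (p : M) (i j : Fin n),
    AEMeasurable (fun x => coordComp p i x (cov x (coordField p j x))) (riemannianMeasure n M)
  approx : ∃ φ : ℕ → ∀ x : M, TangentSpace (𝓡 n) x,
    (∀ k, IsSmoothField (φ k)) ∧
    Tendsto (fun k => eLpNorm (fun x => ‖φ k x - field x‖) 2 (riemannianMeasure n M))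
      atTop (𝓝 0) ∧
    Tendsto (fun k => eLpNorm (fun x => Real.sqrt (tensorInner (covDeriv (φ k) x - cov x)
      (covDeriv (φ k) x - cov x))) 2 (riemannianMeasure n M)) atTop (𝓝 0)

variable [MeasurableSpace M]

/-- The `L²` norm of a vector field in `H¹`. -/
def normL2 (u : H1Field n M) : ℝ :=
  Real.sqrt (∫ x, inner ℝ (u.field x) (u.field x) ∂(riemannianMeasure n M))

/-- The `H¹` norm. -/
def normH1 (u : H1Field n M) : ℝ :=
  Real.sqrt (∫ x, (inner ℝ (u.field x) (u.field x) + tensorInner (u.cov x) (u.cov x))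
    ∂(riemannianMeasure n M))

/-- `a_K(u, v) = ½ ∫ g(S_u, S_v)`. -/
def formK (u v : H1Field n M) : ℝ :=
  (1 / 2 : ℝ) * ∫ x, tensorInner (killingOp (u.cov x)) (killingOp (v.cov x))
    ∂(riemannianMeasure n M)

/-- `a_C(u, v) = ½ ∫ g(C_u, C_v)`. -/
def formC (u v : H1Field n M) : ℝ :=
  (1 / 2 : ℝ) * ∫ x, tensorInner (conformalOp (u.cov x)) (conformalOp (v.cov x))
    ∂(riemannianMeasure n M)

/-- Coercivity of a form on `H¹(M)` relative to `L²(M)`. -/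
def IsCoerciveForm (a : H1Field n M → H1Field n M → ℝ) : Prop :=
  ∃ α : ℝ, 0 < α ∧ ∃ μ : ℝ, ∀ v : H1Field n M,
    α * normH1 v ^ 2 ≤ a v v + μ * normL2 v ^ 2

end Riemannian

end RiemannianKorn

end

noncomputable section

namespace RiemannianKorn

/-! ### Local Riemannian geometry on `ℝⁿ` -/

section Local

variable {n : ℕ}

/-! The engine is Yano's form of Bochner's identity. For a smooth field `u` the divergence of `∇_u u
- div(u) u` equals `tr(∇u ∘ ∇u) - div(u)² + Ri(u,u)`. Since `½|S_u|² = |∇u|² + tr(∇u ∘ ∇u)` and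
`|C_u|² = |S_u|² - (4/n) div(u)²`, this gives pointwise `½|S_u|² = |∇u|² + div(u)² - Ri(u,u) +
divergence` and `½|C_u|² = |∇u|² + (1 - 2/n) div(u)² - Ri(u,u) + divergence`
(`half_tensorInner_killingOp`, `half_tensorInner_conformalOp`). The divergence integrates to zero
(`integral_trace_covDeriv`), the square has a nonnegative coefficient (for `C_u` because `n ≥ 2`),
and `Ri(u,u) ≤ μ|u|²`. So both energies are at least `∫|∇u|² - μ∫|u|²`, which is the Korn inequality
for smooth fields (`korn_of_bochner`). If `S_u` or `C_u` vanishes, the same identity gives `∫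
-Ri(u,u) ≤ 0`. For negative definite `Ri` this forces `u = 0`, because the integrand is continuous
and the measure charges open sets (`eq_zero_of_bochner`).

For `H¹` fields every quadratic integral involved is the limit of the integrals along a smooth
approximating sequence (`H1Field.exists_approx`), so the inequalities pass to the limit. Coercivity
then follows because `Ri` is continuous and `M` is compact (`bddAbove_norm_ricci`).

At each point `∇u` and `Ri` are computed in the chart at that very point, so independence of the
chart has to be proved. For `∇u` it follows from the Koszul formula (`bil_localCov`,
`localCov_transform`). For `Ri` it comes from the Bochner identity itself: the identity holds in
every chart and all its other terms are already intrinsic (`inner_ricci`). -/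

/-- The Christoffel symbols of a matrix valued function. -/
def localChristoffel (G : Model n → Matrix (Fin n) (Fin n) ℝ) (k i j : Fin n) (y : Model n) : ℝ :=
  (1 / 2 : ℝ) * ∑ l, (G y)⁻¹ k l *
    (partialDeriv i (fun z => G z j l) y + partialDeriv j (fun z => G z i l) y
      - partialDeriv l (fun z => G z i j) y)

/-- The covariant derivative in `ℝⁿ` with respect to given connection coefficients. -/
def localCov (Γ : Fin n → Fin n → Fin n → Model n → ℝ) (X : Fin n → Model n → ℝ) (y : Model n) :
    Matrix (Fin n) (Fin n) ℝ :=
  Matrix.of fun k j => partialDeriv j (X k) y + ∑ i, Γ k i j y * X i y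

/-- The bilinear form on `ℝⁿ` given by a matrix. -/
def bil (A : Matrix (Fin n) (Fin n) ℝ) (a b : Fin n → ℝ) : ℝ :=
  ∑ i, ∑ j, A i j * (a i * b j)

theorem bil_eq_dotProduct (A : Matrix (Fin n) (Fin n) ℝ) (a b : Fin n → ℝ) :
    bil A a b = dotProduct a (A.mulVec b) := by
  simp only [bil, dotProduct, Matrix.mulVec, Finset.mul_sum]
  exact Finset.sum_congr rfl fun i _ => Finset.sum_congr rfl fun j _ => by ring

theorem bil_add_left (A : Matrix (Fin n) (Fin n) ℝ) (a a' b : Fin n → ℝ) :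
    bil A (a + a') b = bil A a b + bil A a' b := by
  simp [bil_eq_dotProduct, add_dotProduct]

theorem bil_comm {A : Matrix (Fin n) (Fin n) ℝ} (h : A.IsSymm) (a b : Fin n → ℝ) :
    bil A a b = bil A b a := by
  unfold bil
  rw [Finset.sum_comm]
  exact Finset.sum_congr rfl fun i _ => Finset.sum_congr rfl fun j _ => by
    rw [h.apply i j]; ring

theorem bil_hasDerivAt {A : ℝ → Matrix (Fin n) (Fin n) ℝ} {A' : Matrix (Fin n) (Fin n) ℝ}
    {a b : ℝ → Fin n → ℝ} {a' b' : Fin n → ℝ} {t : ℝ}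
    (hA : ∀ i j, HasDerivAt (fun s => A s i j) (A' i j) t)
    (ha : ∀ i, HasDerivAt (fun s => a s i) (a' i) t)
    (hb : ∀ i, HasDerivAt (fun s => b s i) (b' i) t) :
    HasDerivAt (fun s => bil (A s) (a s) (b s))
      (bil A' (a t) (b t) + bil (A t) a' (b t) + bil (A t) (a t) b') t := by
  have := HasDerivAt.fun_sum (u := Finset.univ) fun i _ => HasDerivAt.fun_sum (u := Finset.univ)
    fun j _ => (hA i j).mul ((ha i).mul (hb j))
  refine this.congr_deriv ?_
  simp only [bil, ← Finset.sum_add_distrib]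
  exact Finset.sum_congr rfl fun i _ => Finset.sum_congr rfl fun j _ => by
    simp only [Pi.mul_apply]; ring

/-- The directional derivative of a matrix valued function. -/
def dMat (G : Model n → Matrix (Fin n) (Fin n) ℝ) (y s : Model n) : Matrix (Fin n) (Fin n) ℝ :=
  Matrix.of fun i j => fderiv ℝ (fun z => G z i j) y s

theorem stdBasis_apply (i j : Fin n) : stdBasis n i j = if j = i then 1 else 0 := by
  simp [stdBasis]

theorem sum_smul_stdBasis (c : Model n) : ∑ i, c i • stdBasis n i = c := by
  ext j
  simp [stdBasis_apply]

theorem fderiv_eq_sum_partialDeriv (f : Model n → ℝ) (y c : Model n) :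
    fderiv ℝ f y c = ∑ i, c i * partialDeriv i f y := by
  conv_lhs => rw [← sum_smul_stdBasis c]
  simp [partialDeriv]

/-- Lowering the upper index cancels `(G y)⁻¹`, so the Koszul formula below involves only `G` and
its first derivatives. -/
theorem sum_mul_localChristoffel {G : Model n → Matrix (Fin n) (Fin n) ℝ} {y : Model n}
    (hu : IsUnit (G y).det) (m i j : Fin n) :
    ∑ k, G y m k * localChristoffel G k i j y = (1 / 2 : ℝ) *
      (partialDeriv i (fun z => G z j m) y + partialDeriv j (fun z => G z i m) y
      - partialDeriv m (fun z => G z i j) y) := by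
  have h := Matrix.mul_nonsing_inv (G y) hu
  set d : Fin n → ℝ := fun l => (partialDeriv i (fun z => G z j l) y
    + partialDeriv j (fun z => G z i l) y - partialDeriv l (fun z => G z i j) y) with hd
  have h2 : (G y).mulVec ((G y)⁻¹.mulVec d) = d := by
    rw [Matrix.mulVec_mulVec, h, Matrix.one_mulVec]
  have h3 := congrFun h2 m
  simp only [Matrix.mulVec, dotProduct] at h3
  change _ = 1 / 2 * d m
  rw [← h3, Finset.mul_sum]
  refine Finset.sum_congr rfl fun k _ => ?_
  simp only [localChristoffel, hd]
  ring

/-- Symmetry of `G` is required in a neighbourhood because its entries are differentiated. -/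
theorem localChristoffel_symm {G : Model n → Matrix (Fin n) (Fin n) ℝ} {y : Model n}
    (hs : ∀ᶠ z in 𝓝 y, (G z).IsSymm) (k i j : Fin n) :
    localChristoffel G k i j y = localChristoffel G k j i y := by
  have h : ∀ l, partialDeriv l (fun z => G z i j) y = partialDeriv l (fun z => G z j i) y := by
    intro l
    have : (fun z => G z i j) =ᶠ[𝓝 y] fun z => G z j i := by
      filter_upwards [hs] with z hz using (hz.apply i j).symm
    simp [partialDeriv, this.fderiv_eq]
  unfold localChristoffel
  congr 1
  refine Finset.sum_congr rfl fun l _ => ?_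
  rw [h l]; ring

theorem bil_dMat (G : Model n → Matrix (Fin n) (Fin n) ℝ) (y s : Model n) (a b : Fin n → ℝ) :
    bil (dMat G y s) a b =
      ∑ k, ∑ i, ∑ j, partialDeriv k (fun z => G z i j) y * (s k * a i * b j) := by
  simp only [bil, dMat, Matrix.of_apply, fderiv_eq_sum_partialDeriv, Finset.sum_mul]
  rw [Finset.sum_comm]
  conv_rhs => rw [Finset.sum_comm]; enter [2, i]; rw [Finset.sum_comm]
  rw [Finset.sum_comm]
  exact Finset.sum_congr rfl fun i _ => Finset.sum_congr rfl fun j _ =>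
    Finset.sum_congr rfl fun k _ => by ring

/-- The Koszul formula for the covariant derivative. -/
theorem bil_localCov {G : Model n → Matrix (Fin n) (Fin n) ℝ} {X : Fin n → Model n → ℝ}
    {y : Model n} (hs : (G y).IsSymm) (hu : IsUnit (G y).det) (w c : Model n) :
    bil (G y) ((localCov (localChristoffel G) X y).mulVec w) c =
      bil (G y) (fun i => fderiv ℝ (X i) y w) c + (1 / 2 : ℝ) *
        (bil (dMat G y (WithLp.toLp 2 fun i => X i y)) w c
        + bil (dMat G y w) (fun i => X i y) c
        - bil (dMat G y c) (fun i => X i y) w) := by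
  have h1 : (localCov (localChristoffel G) X y).mulVec w =
      (fun i => fderiv ℝ (X i) y w) +
        fun k => ∑ i, ∑ j, localChristoffel G k i j y * (X i y * w j) := by
    ext k
    simp only [localCov, Matrix.mulVec, dotProduct, Matrix.of_apply, add_mul,
      Finset.sum_add_distrib, Pi.add_apply, fderiv_eq_sum_partialDeriv, Finset.sum_mul]
    congr 1
    · exact Finset.sum_congr rfl fun i _ => by ring
    · rw [Finset.sum_comm]
      exact Finset.sum_congr rfl fun i _ => Finset.sum_congr rfl fun j _ => by ring
  rw [h1, bil_add_left]
  congr 1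
  have h2 : bil (G y) (fun k => ∑ i, ∑ j, localChristoffel G k i j y * (X i y * w j)) c =
      ∑ m, ∑ i, ∑ j, (∑ k, G y m k * localChristoffel G k i j y) * (X i y * w j * c m) := by
    simp only [bil, Finset.sum_mul, Finset.mul_sum]
    rw [Finset.sum_comm]
    refine Finset.sum_congr rfl fun m _ => ?_
    rw [Finset.sum_comm]
    refine Finset.sum_congr rfl fun i _ => ?_
    rw [Finset.sum_comm]
    refine Finset.sum_congr rfl fun j _ => Finset.sum_congr rfl fun k _ => ?_
    rw [hs.apply m k]; ring
  rw [h2]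
  simp only [sum_mul_localChristoffel hu, bil_dMat]
  have e1 : ∑ k, ∑ i, ∑ j, partialDeriv k (fun z => G z i j) y * (X k y * w i * c j) =
      ∑ m, ∑ i, ∑ j, partialDeriv i (fun z => G z j m) y * (X i y * w j * c m) := by
    conv_rhs => rw [Finset.sum_comm]; enter [2, i]; rw [Finset.sum_comm]
  have e2 : ∑ k, ∑ i, ∑ j, partialDeriv k (fun z => G z i j) y * (w k * X i y * c j) =
      ∑ m, ∑ i, ∑ j, partialDeriv j (fun z => G z i m) y * (X i y * w j * c m) := by
    rw [Finset.sum_comm]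
    conv_lhs => enter [2, i]; rw [Finset.sum_comm]
    rw [Finset.sum_comm]
    exact Finset.sum_congr rfl fun i _ => Finset.sum_congr rfl fun j _ =>
      Finset.sum_congr rfl fun k _ => by ring
  have e3 : ∑ k, ∑ i, ∑ j, partialDeriv k (fun z => G z i j) y * (c k * X i y * w j) =
      ∑ m, ∑ i, ∑ j, partialDeriv m (fun z => G z i j) y * (X i y * w j * c m) :=
    Finset.sum_congr rfl fun i _ => Finset.sum_congr rfl fun j _ =>
      Finset.sum_congr rfl fun k _ => by ring
  simp only [e1, e2, e3, ← Finset.sum_add_distrib, ← Finset.sum_sub_distrib, Finset.mul_sum]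
  exact Finset.sum_congr rfl fun i _ => Finset.sum_congr rfl fun j _ =>
    Finset.sum_congr rfl fun k _ => by ring

/-- Naturality of the covariant derivative under a change of coordinates. -/
theorem localCov_transform {G G' : Model n → Matrix (Fin n) (Fin n) ℝ}
    {X Y : Fin n → Model n → ℝ} {τ : Model n → Model n} {y : Model n}
    (hτ : ContDiffAt ℝ 2 τ y)
    (hG : ∀ i j, DifferentiableAt ℝ (fun z => G z i j) y) (hs : (G y).IsSymm)
    (hu : IsUnit (G y).det) (hX : ∀ i, DifferentiableAt ℝ (X i) y)
    (hG' : ∀ i j, DifferentiableAt ℝ (fun z => G' z i j) (τ y)) (hs' : (G' (τ y)).IsSymm)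
    (hu' : IsUnit (G' (τ y)).det) (hY : ∀ i, DifferentiableAt ℝ (Y i) (τ y))
    (hsurj : Function.Surjective (fderiv ℝ τ y))
    (hGG' : ∀ᶠ z in 𝓝 y, ∀ a b : Model n, bil (G z) a b =
      bil (G' (τ z)) (fderiv ℝ τ z a) (fderiv ℝ τ z b))
    (hXY : ∀ᶠ z in 𝓝 y, ∀ i, Y i (τ z) = fderiv ℝ τ z (WithLp.toLp 2 fun i => X i z) i)
    (w : Model n) :
    (fderiv ℝ τ y (WithLp.toLp 2 ((localCov (localChristoffel G) X y).mulVec w))).ofLp =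
      (localCov (localChristoffel G') Y (τ y)).mulVec (fderiv ℝ τ y w) := by
  -- The metric `G'` is nondegenerate and the differential of `τ` is onto, so a vector is determined
  -- by its products with the image of the differential. Both sides can then be compared through the
  -- Koszul formula.
  have hinj : ∀ a b : Fin n → ℝ, (∀ c, bil (G' (τ y)) a (fderiv ℝ τ y c) =
      bil (G' (τ y)) b (fderiv ℝ τ y c)) → a = b := by
    intro a b h
    have h1 : ∀ c : Fin n → ℝ, dotProduct (Matrix.mulVec (G' (τ y)) (a - b)) c = 0 := by
      intro c
      obtain ⟨d, hd⟩ := hsurj (WithLp.toLp 2 c)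
      have := h d
      rw [hd, bil_comm hs' a, bil_comm hs' b, bil_eq_dotProduct, bil_eq_dotProduct] at this
      rw [Matrix.mulVec_sub, sub_dotProduct, dotProduct_comm, dotProduct_comm _ c]
      exact sub_eq_zero.2 this
    have h2 := dotProduct_eq_zero _ h1
    have h3 := congrArg (Matrix.mulVec (G' (τ y))⁻¹) h2
    rw [Matrix.mulVec_mulVec, Matrix.nonsing_inv_mul _ hu', Matrix.one_mulVec,
      Matrix.mulVec_zero] at h3
    exact sub_eq_zero.1 h3
  refine hinj _ _ fun c => ?_
  have hτ1 : DifferentiableAt ℝ (fderiv ℝ τ) y :=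
    (hτ.fderiv_right (m := 1) (by norm_num)).differentiableAt (by norm_num)
  have hτ0 : DifferentiableAt ℝ τ y := hτ.differentiableAt (by norm_num)
  set D := fderiv ℝ (fderiv ℝ τ) y with hD
  have hτa : ∀ (a : Model n) (s : Model n) (i : Fin n), HasLineDerivAt ℝ
      (fun z => fderiv ℝ τ z a i) (D s a i) y s := by
    intro a s i
    have := ((EuclideanSpace.proj i : Model n →L[ℝ] ℝ).hasFDerivAt.comp y
      (hτ1.hasFDerivAt.clm_apply (hasFDerivAt_const a y))).hasLineDerivAt s
    simpa using! this
  have hsymm : ∀ a b, D a b = D b a := fun a b =>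
    hτ.isSymmSndFDerivAt (by simp) a b
  -- derivative of the pulled back metric
  have key : ∀ s a b : Model n, bil (dMat G y s) a b =
      bil (dMat G' (τ y) (fderiv ℝ τ y s)) (fderiv ℝ τ y a) (fderiv ℝ τ y b)
        + bil (G' (τ y)) (D s a) (fderiv ℝ τ y b) + bil (G' (τ y)) (fderiv ℝ τ y a) (D s b) := by
    intro s a b
    have h1 := bil_hasDerivAt (t := 0) (A := fun t => G (y + t • s)) (A' := dMat G y s)
      (a := fun _ => a) (b := fun _ => b) (a' := 0) (b' := 0)
      (fun i j => (hG i j).hasFDerivAt.hasLineDerivAt s)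
      (fun i => hasDerivAt_const _ _) (fun i => hasDerivAt_const _ _)
    have h2 := bil_hasDerivAt (t := 0) (A := fun t => G' (τ (y + t • s)))
      (A' := dMat G' (τ y) (fderiv ℝ τ y s))
      (a := fun t => fderiv ℝ τ (y + t • s) a) (b := fun t => fderiv ℝ τ (y + t • s) b)
      (fun i j => ((hG' i j).hasFDerivAt.comp y hτ0.hasFDerivAt).hasLineDerivAt s)
      (fun i => hτa a s i) (fun i => hτa b s i)
    have hev : ∀ᶠ t : ℝ in 𝓝 0, bil (G (y + t • s)) a b = bil (G' (τ (y + t • s)))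
        (fderiv ℝ τ (y + t • s) a) (fderiv ℝ τ (y + t • s) b) := by
      have : Tendsto (fun t : ℝ => y + t • s) (𝓝 0) (𝓝 y) := by
        have : Continuous fun t : ℝ => y + t • s := by fun_prop
        simpa using this.tendsto 0
      filter_upwards [this.eventually hGG'] with t ht using ht a b
    have h3 := h1.unique (h2.congr_of_eventuallyEq hev)
    simpa [bil] using h3
  -- Differentiating the transformation law of the field produces the second derivative of `τ`, the
  -- term that spoils naturality of the plain derivative.
  have hXY' : (fun i => fderiv ℝ (Y i) (τ y) (fderiv ℝ τ y w)) =
      (D w (WithLp.toLp 2 fun i => X i y)).ofLp +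
        (fderiv ℝ τ y (WithLp.toLp 2 fun i => fderiv ℝ (X i) y w)).ofLp := by
    ext i
    have hXd : HasFDerivAt (fun z => (WithLp.toLp 2 fun i => X i z : Model n))
        ((PiLp.continuousLinearEquiv 2 ℝ (fun _ : Fin n => ℝ)).symm.toContinuousLinearMap.comp
          (ContinuousLinearMap.pi fun i => fderiv ℝ (X i) y)) y :=
      (PiLp.continuousLinearEquiv 2 ℝ (fun _ : Fin n => ℝ)).symm.hasFDerivAt.comp y
        (hasFDerivAt_pi.2 fun i => (hX i).hasFDerivAt)
    have h1 := (hY i).hasFDerivAt.comp y hτ0.hasFDerivAt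
    have h2 := (EuclideanSpace.proj i : Model n →L[ℝ] ℝ).hasFDerivAt.comp y
      (hτ1.hasFDerivAt.clm_apply hXd)
    have h3 := h2.congr_of_eventuallyEq (f₁ := (Y i) ∘ τ)
      (by filter_upwards [hXY] with z hz using hz i)
    have h4 := congrArg (fun L => L w) (h1.unique h3)
    simp at h4
    rw [h4]
    simp only [Pi.add_apply]
    rw [add_comm]
  have hXY0 : (WithLp.toLp 2 fun i => Y i (τ y) : Model n) =
      fderiv ℝ τ y (WithLp.toLp 2 fun i => X i y) := by
    ext i; exact hXY.self_of_nhds i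
  have hXY1 : (fun i => Y i (τ y)) = (fderiv ℝ τ y (WithLp.toLp 2 fun i => X i y)).ofLp := by
    ext i; exact hXY.self_of_nhds i
  have hGG0 := hGG'.self_of_nhds
  have e := hGG0 (WithLp.toLp 2 ((localCov (localChristoffel G) X y).mulVec w)) c
  have e2 := hGG0 (WithLp.toLp 2 fun i => fderiv ℝ (X i) y w) c
  rw [← e, bil_localCov hs hu, bil_localCov hs' hu', hXY', hXY0, hXY1, bil_add_left, ← e2]
  -- These are the three metric derivatives of the Koszul formula. As the second derivative `D` of
  -- `τ` is symmetric, four of the six terms containing it cancel. The other two, each with factor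
  -- `1/2`, add up to the extra term of `hXY'`.
  have k1 := key (WithLp.toLp 2 fun i => X i y) w c
  have k2 := key w (WithLp.toLp 2 fun i => X i y) c
  have k3 := key c (WithLp.toLp 2 fun i => X i y) w
  rw [hsymm (WithLp.toLp 2 fun i => X i y) w] at k1
  rw [hsymm c (WithLp.toLp 2 fun i => X i y), hsymm c w] at k3
  rw [bil_comm hs' (D (WithLp.toLp 2 fun i => X i y) c).ofLp] at k3
  simp only at k1 k2 k3 ⊢
  rw [k1, k2, k3]
  ring

end Local

/-! ### The divergence in coordinates: Jacobi's formula and the density `√det g` -/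

section LocalDivergence

variable {n : ℕ}

/-- Jacobi's formula. -/
theorem hasDerivAt_det {A : ℝ → Matrix (Fin n) (Fin n) ℝ} {A' : Matrix (Fin n) (Fin n) ℝ} {t : ℝ}
    (hA : ∀ i j, HasDerivAt (fun s => A s i j) (A' i j) t) :
    HasDerivAt (fun s => (A s).det) (((A t).adjugate * A').trace) t := by
  -- The determinant is multilinear in the rows, so its derivative is a sum of determinants with one
  -- row replaced. Cramer's rule turns these into entries of the adjugate.
  let f : ContinuousMultilinearMap ℝ (fun _ : Fin n => Fin n → ℝ) ℝ :=
    { toMultilinearMap := Matrix.detRowAlternating.toMultilinearMap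
      cont := Continuous.matrix_det continuous_id }
  have hA' : HasDerivAt (fun s => (fun i => A s i : Fin n → Fin n → ℝ)) (fun i => A' i) t :=
    hasDerivAt_pi.2 fun i => hasDerivAt_pi.2 fun j => hA i j
  have h := (f.hasFDerivAt (fun i => A t i)).comp_hasDerivAt t hA'
  refine h.congr_deriv ?_
  rw [ContinuousMultilinearMap.linearDeriv_apply, Matrix.trace_mul_comm]
  simp only [Matrix.trace, Matrix.diag, Matrix.mul_apply]
  refine Finset.sum_congr rfl fun i _ => ?_
  change (Matrix.updateRow (A t) i (A' i)).det = _
  rw [← Matrix.cramer_transpose_apply, Matrix.cramer_eq_adjugate_mulVec,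
    ← Matrix.adjugate_transpose]
  simp only [Matrix.mulVec, dotProduct, Matrix.transpose_apply]
  exact Finset.sum_congr rfl fun j _ => mul_comm _ _

theorem contDiffOn_det {U : Set (Model n)} {A : Model n → Matrix (Fin n) (Fin n) ℝ}
    (hA : ∀ i j, ContDiffOn ℝ ∞ (fun z => A z i j) U) :
    ContDiffOn ℝ ∞ (fun z => (A z).det) U := by
  simp only [Matrix.det_apply]
  exact ContDiffOn.sum fun σ _ => (contDiffOn_prod fun i _ => hA _ _).const_smul _

theorem contDiffOn_inv {U : Set (Model n)} {A : Model n → Matrix (Fin n) (Fin n) ℝ}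
    (hA : ∀ i j, ContDiffOn ℝ ∞ (fun z => A z i j) U) (hu : ∀ z ∈ U, (A z).det ≠ 0)
    (i j : Fin n) : ContDiffOn ℝ ∞ (fun z => (A z)⁻¹ i j) U := by
  have h1 : ContDiffOn ℝ ∞ (fun z => (A z).adjugate i j) U := by
    simp only [Matrix.adjugate_apply]
    refine contDiffOn_det fun k l => ?_
    by_cases h : k = j
    · subst h
      simpa using contDiffOn_const
    · simpa [Matrix.updateRow_ne h] using hA k l
  refine (((contDiffOn_det hA).inv hu).mul h1).congr fun z _ => ?_
  simp [Matrix.inv_def]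

theorem contDiffOn_partialDeriv {U : Set (Model n)} (hU : IsOpen U) {f : Model n → ℝ}
    (hf : ContDiffOn ℝ ∞ f U) (i : Fin n) : ContDiffOn ℝ ∞ (partialDeriv i f) U :=
  (hf.fderiv_of_isOpen hU (m := ∞) (by simp)).clm_apply contDiffOn_const

theorem contDiffOn_localChristoffel {U : Set (Model n)} (hU : IsOpen U)
    {G : Model n → Matrix (Fin n) (Fin n) ℝ}
    (hG : ∀ i j, ContDiffOn ℝ ∞ (fun z => G z i j) U) (hu : ∀ z ∈ U, (G z).det ≠ 0)
    (k i j : Fin n) : ContDiffOn ℝ ∞ (localChristoffel G k i j) U := by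
  have := contDiffOn_inv hG hu
  exact contDiffOn_const.mul (ContDiffOn.sum fun l _ => (this k l).mul
    (((contDiffOn_partialDeriv hU (hG j l) i).add (contDiffOn_partialDeriv hU (hG i l) j)).sub
      (contDiffOn_partialDeriv hU (hG i j) l)))

theorem contDiffOn_localCov {U : Set (Model n)} (hU : IsOpen U)
    {Γ : Fin n → Fin n → Fin n → Model n → ℝ} (hΓ : ∀ k i j, ContDiffOn ℝ ∞ (Γ k i j) U)
    {X : Fin n → Model n → ℝ} (hX : ∀ i, ContDiffOn ℝ ∞ (X i) U) (k j : Fin n) :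
    ContDiffOn ℝ ∞ (fun z => localCov Γ X z k j) U :=
  (contDiffOn_partialDeriv hU (hX k) j).add
    (ContDiffOn.sum fun i _ => (hΓ k i j).mul (hX i))

/-- In the contraction two of the three metric derivatives cancel after exchanging the summation
indices, as `G⁻¹` is symmetric. What remains is half the logarithmic derivative of `det G`. -/
theorem sum_localChristoffel_self {G : Model n → Matrix (Fin n) (Fin n) ℝ} {y : Model n}
    (hs : ∀ᶠ z in 𝓝 y, (G z).IsSymm) (i : Fin n) :
    ∑ k, localChristoffel G k i k y =
      (1 / 2 : ℝ) * ((G y)⁻¹ * dMat G y (stdBasis n i)).trace := by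
  have hsy : (G y)⁻¹.IsSymm := hs.self_of_nhds.inv
  have hd : ∀ k l m, partialDeriv k (fun z => G z l m) y = partialDeriv k (fun z => G z m l) y := by
    intro k l m
    have : (fun z => G z l m) =ᶠ[𝓝 y] fun z => G z m l := by
      filter_upwards [hs] with z hz using (hz.apply l m).symm
    simp [partialDeriv, this.fderiv_eq]
  simp only [localChristoffel, ← Finset.mul_sum, Matrix.trace, Matrix.diag, Matrix.mul_apply]
  congr 1
  have h1 : ∑ k, ∑ l, (G y)⁻¹ k l * partialDeriv k (fun z => G z i l) y =
      ∑ k, ∑ l, (G y)⁻¹ k l * partialDeriv l (fun z => G z i k) y := by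
    rw [Finset.sum_comm]
    exact Finset.sum_congr rfl fun k _ => Finset.sum_congr rfl fun l _ => by rw [hsy.apply k l]
  simp only [mul_add, mul_sub, Finset.sum_add_distrib, Finset.sum_sub_distrib, h1]
  rw [add_sub_cancel_right]
  refine Finset.sum_congr rfl fun k _ => Finset.sum_congr rfl fun l _ => ?_
  rw [hd i k l]
  rfl

/-- Jacobi's formula differentiates `det G`, and the square root contributes the factor `1/2` that
matches the contracted Christoffel symbol. -/
theorem hasLineDerivAt_sqrt_det {G : Model n → Matrix (Fin n) (Fin n) ℝ} {y : Model n}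
    (hG : ∀ i j, DifferentiableAt ℝ (fun z => G z i j) y) (hs : ∀ᶠ z in 𝓝 y, (G z).IsSymm)
    (hpos : 0 < (G y).det) (i : Fin n) :
    HasLineDerivAt ℝ (fun z => Real.sqrt (G z).det)
      (Real.sqrt (G y).det * ∑ k, localChristoffel G k i k y) y (stdBasis n i) := by
  have h1 := hasDerivAt_det (t := 0) (A := fun t => G (y + t • stdBasis n i))
    (A' := dMat G y (stdBasis n i))
    (fun k l => (hG k l).hasFDerivAt.hasLineDerivAt (stdBasis n i))
  have h2 := h1.sqrt (by simpa using hpos.ne')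
  refine HasDerivAt.congr_deriv h2 ?_
  rw [sum_localChristoffel_self hs]
  simp only [zero_smul, add_zero, Matrix.inv_def, Matrix.smul_mul, Matrix.trace_smul, smul_eq_mul,
    Ring.inverse_eq_inv']
  have hsq := Real.mul_self_sqrt hpos.le
  have hsp := Real.sqrt_pos.2 hpos
  rw [div_eq_iff (by positivity)]
  field_simp
  rw [sq, hsq]

/-- The divergence in density form. -/
theorem sqrt_det_mul_trace_localCov {U : Set (Model n)} (hU : IsOpen U)
    {G : Model n → Matrix (Fin n) (Fin n) ℝ}
    (hG : ∀ i j, ContDiffOn ℝ ∞ (fun z => G z i j) U) (hs : ∀ z ∈ U, (G z).IsSymm)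
    (hpos : ∀ z ∈ U, 0 < (G z).det) {X : Fin n → Model n → ℝ} {y : Model n} (hy : y ∈ U)
    (hX : ∀ i, DifferentiableAt ℝ (X i) y) :
    Real.sqrt (G y).det * (localCov (localChristoffel G) X y).trace =
      ∑ k, partialDeriv k (fun z => Real.sqrt (G z).det * X k z) y := by
  have hGd : ∀ i j, DifferentiableAt ℝ (fun z => G z i j) y := fun i j =>
    ((hG i j).contDiffAt (hU.mem_nhds hy)).differentiableAt (by simp)
  have hsd : DifferentiableAt ℝ (fun z => Real.sqrt (G z).det) y :=
    (((contDiffOn_det hG).contDiffAt (hU.mem_nhds hy)).differentiableAt (by simp)).sqrt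
      (hpos y hy).ne'
  have hsn : ∀ᶠ z in 𝓝 y, (G z).IsSymm := by
    filter_upwards [hU.mem_nhds hy] with z hz using hs z hz
  have h1 : ∀ k, partialDeriv k (fun z => Real.sqrt (G z).det) y =
      Real.sqrt (G y).det * ∑ l, localChristoffel G l k l y := fun k =>
    (hsd.hasFDerivAt.hasLineDerivAt (stdBasis n k)).unique
      (hasLineDerivAt_sqrt_det hGd hsn (hpos y hy) k)
  have h2 : ∀ k, partialDeriv k (fun z => Real.sqrt (G z).det * X k z) y =
      Real.sqrt (G y).det * partialDeriv k (X k) y +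
        X k y * (Real.sqrt (G y).det * ∑ l, localChristoffel G l k l y) := by
    intro k
    rw [← h1]
    simp only [partialDeriv]
    rw [fderiv_fun_mul hsd (hX k)]
    simp
  simp only [h2, Matrix.trace, Matrix.diag, localCov, Matrix.of_apply, Finset.sum_add_distrib,
    mul_add, Finset.mul_sum]
  congr 1
  rw [Finset.sum_comm]
  exact Finset.sum_congr rfl fun i _ => Finset.sum_congr rfl fun j _ => by ring

end LocalDivergence

/-! ### The Bochner identity in coordinates -/

section LocalBochner

variable {n : ℕ}

/-- The Ricci tensor of given connection coefficients. -/
def localRicci (Γ : Fin n → Fin n → Fin n → Model n → ℝ) (y : Model n) :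
    Matrix (Fin n) (Fin n) ℝ :=
  Matrix.of fun j k => ∑ i,
    (partialDeriv i (Γ i j k) y - partialDeriv j (Γ i i k) y
      + ∑ l, (Γ i i l y * Γ l j k y - Γ i j l y * Γ l i k y))

/-- This is the Bochner identity at one point, with all values and derivatives treated as
independent symbols. `A` and `B` stand for `∇u` and `∇v`, `D2` for the second derivatives of `v`,
and `dΓ`, `dB` for the first derivatives of `Γ` and `B`. The left side is the divergence of `∇_u v -
div(v) u`. Only symmetry of second derivatives and of the lower indices of `Γ` is needed. -/
theorem bochner_algebra (u v : Fin n → ℝ) (Du Dv : Fin n → Fin n → ℝ)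
    (D2 : Fin n → Fin n → Fin n → ℝ) (hD2 : ∀ m k j, D2 m k j = D2 j k m)
    (Γ : Fin n → Fin n → Fin n → ℝ) (hΓ : ∀ k i j, Γ k i j = Γ k j i)
    (dΓ : Fin n → Fin n → Fin n → Fin n → ℝ) (hdΓ : ∀ m k i j, dΓ m k i j = dΓ m k j i)
    (A B : Fin n → Fin n → ℝ) (hA : ∀ k j, A k j = Du k j + ∑ i, Γ k i j * u i)
    (hB : ∀ k j, B k j = Dv k j + ∑ i, Γ k i j * v i)
    (dB : Fin n → Fin n → Fin n → ℝ)
    (hdB : ∀ m k j, dB m k j = D2 m k j + ∑ i, (dΓ m k i j * v i + Γ k i j * Dv i m)) :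
    ∑ k, ((∑ j, (dB k k j * u j + B k j * Du j k) -
        ((∑ l, dB k l l) * u k + (∑ l, B l l) * Du k k)) +
      ∑ i, Γ k i k * (∑ j, B i j * u j - (∑ l, B l l) * u i)) =
    ∑ k, ∑ j, A k j * B j k - (∑ k, A k k) * (∑ k, B k k) +
      ∑ j, ∑ k, (∑ i, (dΓ i i j k - dΓ j i i k +
        ∑ l, (Γ i i l * Γ l j k - Γ i j l * Γ l i k))) * (u j * v k) := by
  -- contraction of `dB` with `u`
  have e1 : ∑ k, ∑ j, dB k k j * u j = ∑ k, ∑ j, D2 k k j * u j +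
      ∑ j, ∑ i, (∑ k, dΓ k k j i) * (u j * v i) + ∑ k, ∑ j, ∑ i, Γ k i j * Dv i k * u j := by
    have : ∑ j, ∑ i, (∑ k, dΓ k k j i) * (u j * v i) =
        ∑ k, ∑ j, ∑ i, dΓ k k i j * v i * u j := by
      simp only [Finset.sum_mul]
      conv_lhs => enter [2, j]; rw [Finset.sum_comm]
      rw [Finset.sum_comm]
      exact Finset.sum_congr rfl fun k _ => Finset.sum_congr rfl fun j _ =>
        Finset.sum_congr rfl fun i _ => by rw [hdΓ]; ring
    rw [this]
    simp only [hdB, Finset.sum_add_distrib, Finset.sum_mul, add_mul, add_assoc]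
  have e2 : ∑ k, (∑ l, dB k l l) * u k = ∑ k, ∑ j, D2 k k j * u j +
      ∑ j, ∑ i, (∑ k, dΓ j k k i) * (u j * v i) + ∑ k, ∑ j, ∑ i, Γ k i k * Dv i j * u j := by
    have h1 : ∑ j, ∑ i, (∑ k, dΓ j k k i) * (u j * v i) =
        ∑ k, ∑ l, ∑ i, dΓ k l i l * v i * u k := by
      simp only [Finset.sum_mul]
      conv_lhs => enter [2, j]; rw [Finset.sum_comm]
      exact Finset.sum_congr rfl fun k _ => Finset.sum_congr rfl fun j _ =>
        Finset.sum_congr rfl fun i _ => by rw [hdΓ]; ring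
    have h2 : ∑ k, ∑ j, D2 k k j * u j = ∑ k, ∑ l, D2 k l l * u k := by
      rw [Finset.sum_comm]
      exact Finset.sum_congr rfl fun k _ => Finset.sum_congr rfl fun j _ => by rw [hD2]
    have h3 : ∑ k, ∑ j, ∑ i, Γ k i k * Dv i j * u j = ∑ k, ∑ l, ∑ i, Γ l i l * Dv i k * u k := by
      rw [Finset.sum_comm]
    rw [h1, h2, h3]
    simp only [hdB, Finset.sum_add_distrib, Finset.sum_mul, add_mul, add_assoc]
  have e3 : ∑ k, ∑ j, A k j * B j k = ∑ k, ∑ j, B k j * Du j k +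
      (∑ k, ∑ j, ∑ i, Γ k i j * Dv i k * u j +
        ∑ k, ∑ j, ∑ i, Γ k i j * (∑ l, Γ i l k * v l) * u j) := by
    have h1 : ∑ k, ∑ j, B k j * Du j k = ∑ k, ∑ j, B j k * Du k j := by rw [Finset.sum_comm]
    have h2 : ∀ f : Fin n → Fin n → ℝ, ∑ k, ∑ j, ∑ i, Γ k i j * f i k * u j =
        ∑ k, ∑ j, ∑ i, Γ k i j * f j k * u i := by
      intro f
      refine Finset.sum_congr rfl fun k _ => ?_
      rw [Finset.sum_comm]
      exact Finset.sum_congr rfl fun j _ => Finset.sum_congr rfl fun i _ => by rw [hΓ]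
    rw [h1, h2, h2 (fun i k => ∑ l, Γ i l k * v l)]
    simp only [← Finset.sum_add_distrib]
    refine Finset.sum_congr rfl fun k _ => Finset.sum_congr rfl fun j _ => ?_
    rw [hA, add_mul, Finset.sum_mul, mul_comm (B j k)]
    congr 1
    refine Finset.sum_congr rfl fun i _ => ?_
    rw [hB]; ring
  have e4 : ∑ k, A k k = ∑ k, Du k k + ∑ k, ∑ i, Γ k i k * u i := by
    simp only [hA, Finset.sum_add_distrib]
  have e5 : ∑ k, ∑ i, Γ k i k * ∑ j, B i j * u j = ∑ k, ∑ j, ∑ i, Γ k i k * Dv i j * u j +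
      ∑ j, ∑ k, (∑ i, ∑ l, Γ i i l * Γ l j k) * (u j * v k) := by
    have h1 : ∑ j, ∑ k, (∑ i, ∑ l, Γ i i l * Γ l j k) * (u j * v k) =
        ∑ k, ∑ j, ∑ i, ∑ l, Γ k i k * (Γ i l j * v l * u j) := by
      simp only [Finset.sum_mul]
      conv_rhs => rw [Finset.sum_comm]
      refine Finset.sum_congr rfl fun j _ => ?_
      rw [Finset.sum_comm]
      refine Finset.sum_congr rfl fun k _ => ?_
      rw [Finset.sum_comm]
      refine Finset.sum_congr rfl fun i _ => Finset.sum_congr rfl fun l _ => ?_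
      rw [hΓ k k i, hΓ i j l]; ring
    rw [h1]
    simp only [← Finset.sum_add_distrib]
    refine Finset.sum_congr rfl fun k _ => ?_
    simp only [Finset.mul_sum]
    rw [Finset.sum_comm]
    refine Finset.sum_congr rfl fun j _ => Finset.sum_congr rfl fun i _ => ?_
    rw [hB, add_mul, mul_add, Finset.sum_mul, Finset.mul_sum]
    congr 1
    ring
  have e6 : ∑ k, ∑ j, ∑ i, Γ k i j * (∑ l, Γ i l k * v l) * u j =
      ∑ j, ∑ k, (∑ i, ∑ l, Γ i j l * Γ l i k) * (u j * v k) := by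
    simp only [Finset.sum_mul, Finset.mul_sum]
    rw [Finset.sum_comm]
    refine Finset.sum_congr rfl fun j _ => ?_
    conv_rhs => rw [Finset.sum_comm]
    refine Finset.sum_congr rfl fun k _ => ?_
    conv_rhs => rw [Finset.sum_comm]
    refine Finset.sum_congr rfl fun i _ => Finset.sum_congr rfl fun l _ => ?_
    rw [hΓ k i j, hΓ i l k]; ring
  -- The second derivatives of `v` in `e1` and `e2` cancel, and their `dΓ` sums form the derivative
  -- part of the Ricci tensor. Its two quadratic parts come from `e5` and from `e6`, which rewrites
  -- the last sum of `e3`.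
  simp only [Finset.sum_add_distrib, Finset.sum_sub_distrib, mul_sub, add_mul, sub_mul, e1, e2,
    e3, e4, e5, e6]
  have e7 : ∑ k, ∑ i, Γ k i k * ((∑ l, B l l) * u i) =
      (∑ l, B l l) * ∑ k, ∑ i, Γ k i k * u i := by
    rw [Finset.mul_sum]
    refine Finset.sum_congr rfl fun k _ => ?_
    rw [Finset.mul_sum]
    exact Finset.sum_congr rfl fun i _ => by ring
  rw [e7, ← Finset.mul_sum]
  ring

/-- Only `v` is differentiated twice, hence the asymmetric regularity assumptions. The formula for
`X` is needed near `y`, because its derivative is taken there. -/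
theorem localCov_bochner {Γ : Fin n → Fin n → Fin n → Model n → ℝ} {y : Model n}
    (hΓ : ∀ k i j, DifferentiableAt ℝ (Γ k i j) y)
    (hsymm : ∀ k i j, Γ k i j =ᶠ[𝓝 y] Γ k j i)
    {u v X : Fin n → Model n → ℝ} (hu : ∀ i, DifferentiableAt ℝ (u i) y)
    (hv : ∀ i, ContDiffAt ℝ 2 (v i) y)
    (hX : ∀ k, X k =ᶠ[𝓝 y] fun z =>
      ∑ j, localCov Γ v z k j * u j z - (localCov Γ v z).trace * u k z) :
    (localCov Γ X y).trace = (localCov Γ u y * localCov Γ v y).trace -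
      (localCov Γ u y).trace * (localCov Γ v y).trace +
      ∑ j, ∑ k, localRicci Γ y j k * (u j y * v k y) := by
  have hdv : ∀ i j, DifferentiableAt ℝ (partialDeriv j (v i)) y := fun i j =>
    (((hv i).fderiv_right (m := 1) (by norm_num)).differentiableAt (by norm_num)).clm_apply
      (differentiableAt_const _)
  have hv1 : ∀ i, DifferentiableAt ℝ (v i) y := fun i => (hv i).differentiableAt (by norm_num)
  have hB : ∀ k j, HasFDerivAt (fun z => localCov Γ v z k j) (fderiv ℝ (partialDeriv j (v k)) y +
      ∑ i, (Γ k i j y • fderiv ℝ (v i) y + v i y • fderiv ℝ (Γ k i j) y)) y := fun k j =>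
    (hdv k j).hasFDerivAt.add (HasFDerivAt.fun_sum fun i _ =>
      (hΓ k i j).hasFDerivAt.mul (hv1 i).hasFDerivAt)
  have hXd : ∀ k m, partialDeriv m (X k) y = ∑ j, (fderiv ℝ (fun z => localCov Γ v z k j) y
        (stdBasis n m) * u j y + localCov Γ v y k j * partialDeriv m (u j) y) -
      ((∑ l, fderiv ℝ (fun z => localCov Γ v z l l) y (stdBasis n m)) * u k y +
        (∑ l, localCov Γ v y l l) * partialDeriv m (u k) y) := by
    intro k m
    have h := (HasFDerivAt.fun_sum (u := Finset.univ) fun j _ =>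
      (hB k j).differentiableAt.hasFDerivAt.mul (hu j).hasFDerivAt).sub
      ((HasFDerivAt.fun_sum (u := Finset.univ) fun l _ =>
        (hB l l).differentiableAt.hasFDerivAt).mul (hu k).hasFDerivAt)
    have h' := h.congr_of_eventuallyEq (hX k)
    simp only [partialDeriv]
    rw [h'.fderiv]
    simp only [sub_apply, add_apply,
      smul_apply, smul_eq_mul, sum_apply]
    congr 1
    · exact Finset.sum_congr rfl fun j _ => by ring
    · ring
  have := bochner_algebra (fun i => u i y) (fun i => v i y) (fun k j => partialDeriv j (u k) y)
    (fun k j => partialDeriv j (v k) y)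
    (fun m k j => partialDeriv m (partialDeriv j (v k)) y) ?_ (fun k i j => Γ k i j y)
    (fun k i j => (hsymm k i j).self_of_nhds) (fun m k i j => partialDeriv m (Γ k i j) y)
    (fun m k i j => by simp [partialDeriv, (hsymm k i j).fderiv_eq]) (localCov Γ u y)
    (localCov Γ v y) (fun _ _ => rfl) (fun _ _ => rfl)
    (fun m k j => fderiv ℝ (fun z => localCov Γ v z k j) y (stdBasis n m)) ?_
  · convert this using 1
    on_goal 2 => simp only [Matrix.trace, Matrix.diag, Matrix.mul_apply]; rfl
    refine Finset.sum_congr rfl fun k _ => ?_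
    conv_lhs => rw [localCov]
    rw [Matrix.diag_apply, Matrix.of_apply, hXd]
    congr 1
    refine Finset.sum_congr rfl fun i _ => ?_
    rw [(hX i).self_of_nhds]
    rfl
  · intro m k j
    have h : ∀ a b : Model n, fderiv ℝ (fun z => fderiv ℝ (v k) z a) y b =
        fderiv ℝ (fderiv ℝ (v k)) y b a := by
      intro a b
      have h1 : DifferentiableAt ℝ (fderiv ℝ (v k)) y :=
        ((hv k).fderiv_right (m := 1) (by norm_num)).differentiableAt (by norm_num)
      rw [(h1.hasFDerivAt.clm_apply (hasFDerivAt_const a y)).fderiv]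
      simp
    change fderiv ℝ (fun z => fderiv ℝ (v k) z _) y _ = fderiv ℝ (fun z => fderiv ℝ (v k) z _) y _
    rw [h, h]
    exact (hv k).isSymmSndFDerivAt (by simp) _ _
  · intro m k j
    rw [(hB k j).fderiv]
    simp [partialDeriv]
    exact Finset.sum_congr rfl fun _ _ => by ring

end LocalBochner

/-! ### Charts, coordinate frames and transition maps -/

section ChartFrames

variable {n : ℕ} {M : Type*} [TopologicalSpace M] [ChartedSpace (Model n) M]

theorem chartPoint_mem {p : M} {y : Model n} (hy : y ∈ (extChartAt (𝓡 n) p).target) :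
    chartPoint p y ∈ (chartAt (Model n) p).source := by
  rw [← extChartAt_source (𝓡 n)]
  exact (extChartAt (𝓡 n) p).map_target hy

theorem extChartAt_chartPoint {p : M} {y : Model n} (hy : y ∈ (extChartAt (𝓡 n) p).target) :
    extChartAt (𝓡 n) p (chartPoint p y) = y :=
  (extChartAt (𝓡 n) p).right_inv hy

theorem chartPoint_extChartAt {p x : M} (hx : x ∈ (chartAt (Model n) p).source) :
    chartPoint p (extChartAt (𝓡 n) p x) = x :=
  (extChartAt (𝓡 n) p).left_inv (by rwa [extChartAt_source])

theorem extChartAt_mem {p x : M} (hx : x ∈ (chartAt (Model n) p).source) :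
    extChartAt (𝓡 n) p x ∈ (extChartAt (𝓡 n) p).target :=
  (extChartAt (𝓡 n) p).map_source (by rwa [extChartAt_source])

theorem continuousOn_chartPoint (p : M) :
    ContinuousOn (chartPoint (n := n) p) (extChartAt (𝓡 n) p).target :=
  continuousOn_extChartAt_symm p

theorem isOpen_preimage_chartPoint (p : M) {U : Set M} (hU : IsOpen U) :
    IsOpen ((extChartAt (𝓡 n) p).target ∩ chartPoint p ⁻¹' U) :=
  (continuousOn_chartPoint p).isOpen_inter_preimage (isOpen_extChartAt_target p) hU

theorem mem_chart_nhds {U : Set M} (hU : IsOpen U) (p : M) {x : M} (hxU : x ∈ U)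
    (hx : x ∈ (chartAt (Model n) p).source) :
    (extChartAt (𝓡 n) p).target ∩ chartPoint p ⁻¹' U ∈ 𝓝 (extChartAt (𝓡 n) p x) :=
  (isOpen_preimage_chartPoint p hU).mem_nhds ⟨extChartAt_mem hx, by
    rwa [Set.mem_preimage, chartPoint_extChartAt hx]⟩

variable [IsManifold (𝓡 n) ∞ M]

/-- The coordinate frame of the chart at `p`, at a point `x` of its domain. -/
def frame (p : M) {x : M} (hx : x ∈ (chartAt (Model n) p).source) :
    Module.Basis (Fin n) ℝ (TangentSpace (𝓡 n) x) :=
  (trivializationAt (Model n) (TangentSpace (𝓡 n)) p).basisAt (stdBasis n) hx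

theorem coordField_eq (p : M) {x : M} (hx : x ∈ (chartAt (Model n) p).source) (i : Fin n) :
    coordField p i x = frame p hx i :=
  Trivialization.localFrame_apply_of_mem_baseSet _ _ hx

theorem coordComp_eq (p : M) {x : M} (hx : x ∈ (chartAt (Model n) p).source) (i : Fin n)
    (v : TangentSpace (𝓡 n) x) : coordComp p i x v = (frame p hx).repr v i := by
  classical
  -- The coefficient formula speaks of sections, so `v` is extended by zero away from `x`.
  have := Trivialization.localFrameCoeff_apply_of_mem_baseSet (I := 𝓡 n)
    (trivializationAt (Model n) (TangentSpace (𝓡 n)) p) (stdBasis n) (x := x) hx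
    (fun z => if h : z = x then h ▸ v else 0) i
  simpa only [dite_true] using! this

/-- The transition map from the chart at `p` to the chart at `q`. -/
def transition (p q : M) (y : Model n) : Model n := extChartAt (𝓡 n) q (chartPoint p y)

theorem tangentCoordChange_eq (p q : M) (x : M) :
    tangentCoordChange (𝓡 n) p q x = fderiv ℝ (transition p q) (extChartAt (𝓡 n) p x) := by
  rw [tangentCoordChange_def]
  simp only [modelWithCornersSelf_coe, Set.range_id, fderivWithin_univ]
  rfl

/-- The tangent space at `x` is by definition the model space, read in the chart at `x`, so the
witness is `v` itself. The existential keeps this definitional identification out of later proofs.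
-/
theorem exists_coordComp_eq_tangentCoordChange {x : M} (v : TangentSpace (𝓡 n) x) :
    ∃ v₀ : Model n, ∀ p, x ∈ (chartAt (Model n) p).source → ∀ i,
      coordComp p i x v = tangentCoordChange (𝓡 n) x p x v₀ i := by
  refine ⟨v, fun p hx i => ?_⟩
  rw [coordComp_eq p hx]
  rfl

/-- The components of a tangent vector transform with the derivative of the transition map. -/
theorem coordComp_transition {p q x : M} (hp : x ∈ (chartAt (Model n) p).source)
    (hq : x ∈ (chartAt (Model n) q).source) (v : TangentSpace (𝓡 n) x) (i : Fin n) :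
    coordComp q i x v = fderiv ℝ (transition p q) (extChartAt (𝓡 n) p x)
      (WithLp.toLp 2 fun j => coordComp p j x v) i := by
  obtain ⟨v₀, hv₀⟩ := exists_coordComp_eq_tangentCoordChange v
  have h : (WithLp.toLp 2 fun j => coordComp p j x v : Model n) =
      tangentCoordChange (𝓡 n) x p x v₀ := by
    ext j
    exact hv₀ p hp j
  rw [h, ← tangentCoordChange_eq, tangentCoordChange_comp, hv₀ q hq]
  simp only [extChartAt_source]
  exact ⟨⟨mem_chart_source _ x, hp⟩, hq⟩

theorem contDiffAt_transition {p q x : M} (hp : x ∈ (chartAt (Model n) p).source)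
    (hq : x ∈ (chartAt (Model n) q).source) :
    ContDiffAt ℝ ∞ (transition p q) (extChartAt (𝓡 n) p x) := by
  have := contDiffWithinAt_ext_coord_change (I := 𝓡 n) (n := ∞) q p
    (y := extChartAt (𝓡 n) p x) (by
      rw [PartialEquiv.trans_source'', PartialEquiv.symm_symm, PartialEquiv.symm_target]
      exact Set.mem_image_of_mem _ ⟨by rwa [extChartAt_source], by rwa [extChartAt_source]⟩)
  simpa [contDiffWithinAt_univ] using! this

theorem fderiv_transition_comp {p q x : M} (hp : x ∈ (chartAt (Model n) p).source)
    (hq : x ∈ (chartAt (Model n) q).source) (v : Model n) :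
    fderiv ℝ (transition p q) (extChartAt (𝓡 n) p x)
      (fderiv ℝ (transition q p) (extChartAt (𝓡 n) q x) v) = v := by
  rw [← tangentCoordChange_eq, ← tangentCoordChange_eq, tangentCoordChange_comp,
    tangentCoordChange_self]
  · rwa [extChartAt_source]
  · simp only [extChartAt_source]
    exact ⟨⟨hq, hp⟩, hq⟩

/-- Smoothness of a vector field on a set, in terms of its components in all charts. -/
def SmoothCoordOn (u : ∀ x : M, TangentSpace (𝓡 n) x) (U : Set M) : Prop :=
  ∀ (p : M) (i : Fin n), ContDiffOn ℝ ∞ (fieldCoord u p i)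
    ((extChartAt (𝓡 n) p).target ∩ chartPoint p ⁻¹' U)

theorem fieldCoord_extChartAt (u : ∀ x : M, TangentSpace (𝓡 n) x) (p : M) {x : M}
    (hx : x ∈ (chartAt (Model n) p).source) (i : Fin n) :
    fieldCoord u p i (extChartAt (𝓡 n) p x) = coordComp p i x (u x) :=
  congrArg (fun z => coordComp p i z (u z)) (chartPoint_extChartAt hx)

theorem contDiffOn_comp_chartPoint {f : M → ℝ} {U : Set M} (p : M)
    (hf : ContMDiffOn (𝓡 n) 𝓘(ℝ, ℝ) ∞ f (U ∩ (chartAt (Model n) p).source)) :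
    ContDiffOn ℝ ∞ (fun y => f (chartPoint p y))
      ((extChartAt (𝓡 n) p).target ∩ chartPoint p ⁻¹' U) := by
  rw [← contMDiffOn_iff_contDiffOn]
  exact hf.comp ((contMDiffOn_extChartAt_symm p).mono Set.inter_subset_left)
    fun y hy => ⟨hy.2, chartPoint_mem hy.1⟩

theorem smoothCoordOn_of_contMDiffOn {u : ∀ x : M, TangentSpace (𝓡 n) x} {U : Set M}
    (hU : IsOpen U)
    (hu : ContMDiffOn (𝓡 n) ((𝓡 n).prod 𝓘(ℝ, Model n)) ∞
      (fun x => (⟨x, u x⟩ : TangentBundle (𝓡 n) M)) U) : SmoothCoordOn u U := by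
  intro p i
  refine contDiffOn_comp_chartPoint (f := fun x => coordComp p i x (u x)) p ?_
  exact contMDiffOn_localFrameCoeff (e := trivializationAt (Model n) (TangentSpace (𝓡 n)) p)
    (stdBasis n) (hU.inter (chartAt (Model n) p).open_source) Set.inter_subset_right
    (hu.mono Set.inter_subset_left) i

theorem IsSmoothField.smoothCoordOn {u : ∀ x : M, TangentSpace (𝓡 n) x} (hu : IsSmoothField u) :
    SmoothCoordOn u Set.univ :=
  smoothCoordOn_of_contMDiffOn isOpen_univ hu.contMDiffOn

theorem contMDiffOn_coordField (p : M) (i : Fin n) :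
    ContMDiffOn (𝓡 n) ((𝓡 n).prod 𝓘(ℝ, Model n)) ∞
      (fun x => (⟨x, coordField p i x⟩ : TangentBundle (𝓡 n) M)) (chartAt (Model n) p).source :=
  (trivializationAt (Model n) (TangentSpace (𝓡 n)) p).contMDiffOn_localFrame_baseSet ∞
    (stdBasis n) i

theorem coordComp_sub (p : M) (i : Fin n) {x : M} (v w : TangentSpace (𝓡 n) x) :
    coordComp p i x (v - w) = coordComp p i x v - coordComp p i x w := map_sub _ _ _

theorem coordComp_smul (p : M) (i : Fin n) {x : M} (c : ℝ) (v : TangentSpace (𝓡 n) x) :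
    coordComp p i x (c • v) = c * coordComp p i x v := map_smul _ _ _

theorem coordComp_sum_smul (p : M) {x : M} (hx : x ∈ (chartAt (Model n) p).source)
    (a : Fin n → ℝ) (i : Fin n) : coordComp p i x (∑ j, a j • frame p hx j) = a i := by
  rw [coordComp_eq p hx, ← Module.Basis.equivFun_apply, ← Module.Basis.equivFun_symm_apply,
    LinearEquiv.apply_symm_apply]

theorem SmoothCoordOn.differentiableAt {u : ∀ x : M, TangentSpace (𝓡 n) x} {U : Set M}
    (hU : IsOpen U) (hu : SmoothCoordOn u U) (p : M) {x : M}
    (hxU : x ∈ U) (hx : x ∈ (chartAt (Model n) p).source) (i : Fin n) :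
    DifferentiableAt ℝ (fieldCoord u p i) (extChartAt (𝓡 n) p x) :=
  ((hu p i).contDiffAt (mem_chart_nhds hU p hxU hx)).differentiableAt (by simp)

end ChartFrames

/-! ### The metric in charts -/

section Metric

variable {n : ℕ} {M : Type*} [TopologicalSpace M] [ChartedSpace (Model n) M]
  [IsManifold (𝓡 n) ∞ M] [RiemannianBundle (fun x : M => TangentSpace (𝓡 n) x)]

theorem metricCoord_isSymm (p : M) (y : Model n) : (metricCoord p y).IsSymm := by
  ext i j
  simp only [metricCoord, Matrix.transpose_apply, Matrix.of_apply]
  exact real_inner_comm _ _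

theorem metricCoord_extChartAt (p : M) {x : M} (hx : x ∈ (chartAt (Model n) p).source)
    (i j : Fin n) : metricCoord p (extChartAt (𝓡 n) p x) i j =
      inner ℝ (coordField p i x) (coordField p j x) :=
  congrArg (fun z => inner ℝ (coordField p i z) (coordField p j z)) (chartPoint_extChartAt hx)

theorem inner_eq_bil (p : M) {x : M} (hx : x ∈ (chartAt (Model n) p).source)
    (v w : TangentSpace (𝓡 n) x) :
    inner ℝ v w = bil (metricCoord p (extChartAt (𝓡 n) p x)) (fun i => coordComp p i x v)
      (fun i => coordComp p i x w) := by
  have hb : ∀ v : TangentSpace (𝓡 n) x, v = ∑ i, coordComp p i x v • coordField p i x := by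
    intro v
    simp only [coordComp_eq p hx, coordField_eq p hx]
    exact ((frame p hx).sum_repr v).symm
  conv_lhs => rw [hb v, hb w]
  rw [sum_inner]
  refine Finset.sum_congr rfl fun i _ => ?_
  rw [inner_sum]
  refine Finset.sum_congr rfl fun j _ => ?_
  rw [real_inner_smul_left, real_inner_smul_right, metricCoord_extChartAt p hx]
  ring

theorem metricCoord_posDef (p : M) {y : Model n} (hy : y ∈ (extChartAt (𝓡 n) p).target) :
    (metricCoord p y).PosDef := by
  refine Matrix.PosDef.of_dotProduct_mulVec_pos ?_ fun a ha => ?_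
  · rw [Matrix.IsHermitian, Matrix.conjTranspose_eq_transpose_of_trivial]
    exact metricCoord_isSymm p y
  have hx := chartPoint_mem hy
  have h := inner_eq_bil p hx (∑ j, a j • frame p hx j) (∑ j, a j • frame p hx j)
  simp only [coordComp_sum_smul, extChartAt_chartPoint hy, bil_eq_dotProduct] at h
  rw [star_trivial, ← h]
  refine real_inner_self_pos.2 fun h0 => ha ?_
  ext i
  rw [← coordComp_sum_smul p hx a i, h0]
  exact map_zero _

theorem metricCoord_det_pos (p : M) {y : Model n} (hy : y ∈ (extChartAt (𝓡 n) p).target) :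
    0 < (metricCoord p y).det := (metricCoord_posDef p hy).det_pos

theorem contDiffOn_metricCoord [IsContMDiffRiemannianBundle (𝓡 n) ∞ (Model n)
    (fun x : M => TangentSpace (𝓡 n) x)] (p : M) (i j : Fin n) :
    ContDiffOn ℝ ∞ (fun y => metricCoord p y i j) (extChartAt (𝓡 n) p).target := by
  have h : ContMDiffOn (𝓡 n) 𝓘(ℝ, ℝ) ∞
      (fun x => inner ℝ (coordField p i x) (coordField p j x)) (chartAt (Model n) p).source :=
    ContMDiffOn.inner_bundle (contMDiffOn_coordField p i) (contMDiffOn_coordField p j)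
  have := contDiffOn_comp_chartPoint (U := Set.univ) p (by rwa [Set.univ_inter])
  rwa [Set.preimage_univ, Set.inter_univ] at this

theorem contDiffOn_christoffel [IsContMDiffRiemannianBundle (𝓡 n) ∞ (Model n)
    (fun x : M => TangentSpace (𝓡 n) x)] (p : M) (k i j : Fin n) :
    ContDiffOn ℝ ∞ (christoffel p k i j) (extChartAt (𝓡 n) p).target :=
  contDiffOn_localChristoffel (isOpen_extChartAt_target p) (contDiffOn_metricCoord p)
    (fun _ hz => (metricCoord_det_pos p hz).ne') k i j

theorem christoffel_symm (p : M) (k i j : Fin n) (y : Model n) :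
    christoffel p k i j y = christoffel p k j i y :=
  localChristoffel_symm (Eventually.of_forall fun z => metricCoord_isSymm p z) k i j

/-- Both sides are the inner product of the same two tangent vectors, those with components `a` and
`b` in the chart at `p`. -/
theorem bil_metricCoord_transition {p q : M} {z : Model n}
    (hp : z ∈ (extChartAt (𝓡 n) p).target) (hq : chartPoint p z ∈ (chartAt (Model n) q).source)
    (a b : Model n) : bil (metricCoord p z) a b = bil (metricCoord q (transition p q z))
      (fderiv ℝ (transition p q) z a) (fderiv ℝ (transition p q) z b) := by
  have hzp := chartPoint_mem hp
  have h1 := inner_eq_bil p hzp (∑ j, a j • frame p hzp j) (∑ j, b j • frame p hzp j)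
  have h2 := inner_eq_bil q hq (∑ j, a j • frame p hzp j) (∑ j, b j • frame p hzp j)
  rw [h1] at h2
  simpa only [coordComp_transition hzp hq, coordComp_sum_smul, extChartAt_chartPoint hp]
    using! h2

/-! ### The covariant derivative in an arbitrary chart -/

variable [IsContMDiffRiemannianBundle (𝓡 n) ∞ (Model n) (fun x : M => TangentSpace (𝓡 n) x)]
variable {u v : ∀ x : M, TangentSpace (𝓡 n) x} {U : Set M}

/-- This is `localCov_transform` for the transition map, whose differential is onto because the
reverse transition inverts it. -/
theorem covDerivCoord_transition (hU : IsOpen U) (hu : SmoothCoordOn u U) {p q x : M}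
    (hxU : x ∈ U) (hp : x ∈ (chartAt (Model n) p).source)
    (hq : x ∈ (chartAt (Model n) q).source) (w : Model n) :
    (fderiv ℝ (transition p q) (extChartAt (𝓡 n) p x) (WithLp.toLp 2
      ((covDerivCoord u p (extChartAt (𝓡 n) p x)).mulVec w))).ofLp =
    (covDerivCoord u q (extChartAt (𝓡 n) q x)).mulVec
      (fderiv ℝ (transition p q) (extChartAt (𝓡 n) p x) w) := by
  have hτ : transition p q (extChartAt (𝓡 n) p x) = extChartAt (𝓡 n) q x := by
    rw [transition, chartPoint_extChartAt hp]
  have hG : ∀ (p : M) (_ : x ∈ (chartAt (Model n) p).source) (i j : Fin n),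
      DifferentiableAt ℝ (fun z => metricCoord p z i j) (extChartAt (𝓡 n) p x) :=
    fun p hp i j => ((contDiffOn_metricCoord p i j).contDiffAt
      ((isOpen_extChartAt_target p).mem_nhds (extChartAt_mem hp))).differentiableAt (by simp)
  have hud : ∀ (p : M) (_ : x ∈ (chartAt (Model n) p).source),
      IsUnit (metricCoord p (extChartAt (𝓡 n) p x)).det :=
    fun p hp => (metricCoord_det_pos p (extChartAt_mem hp)).ne'.isUnit
  have hnear : ∀ᶠ z in 𝓝 (extChartAt (𝓡 n) p x), z ∈ (extChartAt (𝓡 n) p).target ∧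
      chartPoint p z ∈ (chartAt (Model n) q).source := by
    filter_upwards [mem_chart_nhds (chartAt (Model n) q).open_source p hq hp] with z hz using hz
  have := localCov_transform (G := metricCoord p) (G' := metricCoord q) (X := fieldCoord u p)
    (Y := fieldCoord u q) (τ := transition p q) (y := extChartAt (𝓡 n) p x)
    ((contDiffAt_transition hp hq).of_le ENat.LEInfty.out) (hG p hp) (metricCoord_isSymm _ _)
    (hud p hp) (hu.differentiableAt hU p hxU hp) (by rw [hτ]; exact hG q hq)
    (metricCoord_isSymm _ _) (by rw [hτ]; exact hud q hq)
    (by rw [hτ]; exact hu.differentiableAt hU q hxU hq)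
    (fun c => ⟨_, fderiv_transition_comp hp hq c⟩) ?_ ?_ w
  · rw [hτ] at this
    exact this
  · filter_upwards [hnear] with z hz a b
    exact bil_metricCoord_transition hz.1 hz.2 a b
  · filter_upwards [hnear] with z hz i
    have hzp := chartPoint_mem hz.1
    have h1 := coordComp_transition hzp hz.2 (u (chartPoint p z)) i
    rw [extChartAt_chartPoint hz.1] at h1
    refine Eq.trans ?_ h1
    simp only [fieldCoord, transition]
    rw [chartPoint_extChartAt hz.2]

/-- The covariant derivative in an arbitrary chart. -/
theorem coordComp_covDeriv (hU : IsOpen U) (hu : SmoothCoordOn u U) (p : M) {x : M}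
    (hxU : x ∈ U) (hp : x ∈ (chartAt (Model n) p).source) (w : TangentSpace (𝓡 n) x)
    (k : Fin n) : coordComp p k x (covDeriv u x w) =
      ∑ j, covDerivCoord u p (extChartAt (𝓡 n) p x) k j * coordComp p j x w := by
  have hx := mem_chart_source (Model n) x
  have h0 : (fun k => coordComp x k x (covDeriv u x w)) =
      (covDerivCoord u x (extChartAt (𝓡 n) x x)).mulVec (fun j => coordComp x j x w) := by
    ext k
    simp only [coordComp_eq x hx]
    have := LinearMap.toMatrix_mulVec_repr (tangentBasis x) (tangentBasis x) (covDeriv u x) w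
    rw [covDeriv, LinearMap.toMatrix_toLin] at this
    exact (congrFun this k).symm
  have h1 := covDerivCoord_transition hU hu hxU hx hp (WithLp.toLp 2 fun j => coordComp x j x w)
  rw [coordComp_transition hx hp]
  rw [h0, h1]
  simp only [← coordComp_transition hx hp, Matrix.mulVec, dotProduct]

theorem toMatrix_covDeriv (hU : IsOpen U) (hu : SmoothCoordOn u U) (p : M) {x : M}
    (hxU : x ∈ U) (hp : x ∈ (chartAt (Model n) p).source) :
    LinearMap.toMatrix (frame p hp) (frame p hp) (covDeriv u x) =
      covDerivCoord u p (extChartAt (𝓡 n) p x) := by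
  ext k j
  rw [LinearMap.toMatrix_apply, ← coordComp_eq, coordComp_covDeriv hU hu p hxU hp]
  simp [coordComp_eq p hp, Finsupp.single_apply]

end Metric

/-! ### Invariance of the Ricci tensor and Yano's identity on the manifold -/

section Bochner

variable {n : ℕ} {M : Type*} [TopologicalSpace M] [ChartedSpace (Model n) M]
  [IsManifold (𝓡 n) ∞ M] [RiemannianBundle (fun x : M => TangentSpace (𝓡 n) x)]

/-- The vector field `∇_u v - div(v) u`. -/
def yanoField (u v : ∀ x : M, TangentSpace (𝓡 n) x) (x : M) : TangentSpace (𝓡 n) x :=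
  covDeriv v x (u x) - LinearMap.trace ℝ _ (covDeriv v x) • u x

/-- The Ricci tensor in the chart centred at the point. -/
theorem inner_ricci_self_chart (x : M) (v w : TangentSpace (𝓡 n) x) :
    inner ℝ (ricci x v) w = ∑ j, ∑ k, ricciCoord x (extChartAt (𝓡 n) x x) j k *
        (coordComp x j x w * coordComp x k x v) := by
  have hx := mem_chart_source (Model n) x
  have h0 : (fun k => coordComp x k x (ricci x v)) =
      ((metricCoord x (extChartAt (𝓡 n) x x))⁻¹ * ricciCoord x (extChartAt (𝓡 n) x x)).mulVec
        (fun j => coordComp x j x v) := by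
    ext k
    simp only [coordComp_eq x hx]
    have := LinearMap.toMatrix_mulVec_repr (tangentBasis x) (tangentBasis x)
      (ricci (n := n) x).toLinearMap v
    rw [ricci, LinearMap.coe_toContinuousLinearMap, LinearMap.toMatrix_toLin] at this
    exact (congrFun this k).symm
  rw [inner_eq_bil x hx, h0, bil_comm (metricCoord_isSymm _ _), bil_eq_dotProduct,
    Matrix.mulVec_mulVec, ← mul_assoc, Matrix.mul_nonsing_inv _
    (metricCoord_det_pos x (extChartAt_mem hx)).ne'.isUnit, one_mul, ← bil_eq_dotProduct]
  rfl

variable [IsContMDiffRiemannianBundle (𝓡 n) ∞ (Model n) (fun x : M => TangentSpace (𝓡 n) x)]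
variable {u v : ∀ x : M, TangentSpace (𝓡 n) x} {U : Set M}

theorem trace_covDeriv (hU : IsOpen U) (hu : SmoothCoordOn u U) (p : M) {x : M}
    (hxU : x ∈ U) (hp : x ∈ (chartAt (Model n) p).source) :
    LinearMap.trace ℝ _ (covDeriv u x) =
      (covDerivCoord u p (extChartAt (𝓡 n) p x)).trace := by
  rw [← toMatrix_covDeriv hU hu p hxU hp, LinearMap.trace_eq_matrix_trace ℝ (frame p hp)]

theorem trace_covDeriv_comp (hU : IsOpen U) (hu : SmoothCoordOn u U) (hv : SmoothCoordOn v U)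
    (p : M) {x : M} (hxU : x ∈ U) (hp : x ∈ (chartAt (Model n) p).source) :
    LinearMap.trace ℝ _ (covDeriv u x ∘ₗ covDeriv v x) =
      (covDerivCoord u p (extChartAt (𝓡 n) p x) *
        covDerivCoord v p (extChartAt (𝓡 n) p x)).trace := by
  rw [← toMatrix_covDeriv hU hu p hxU hp, ← toMatrix_covDeriv hU hv p hxU hp,
    LinearMap.trace_eq_matrix_trace ℝ (frame p hp), LinearMap.toMatrix_comp _ (frame p hp)]

theorem fieldCoord_yanoField (hU : IsOpen U) (hv : SmoothCoordOn v U) (p : M) {y : Model n}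
    (hy : y ∈ (extChartAt (𝓡 n) p).target ∩ chartPoint p ⁻¹' U) (k : Fin n) :
    fieldCoord (yanoField u v) p k y = ∑ j, covDerivCoord v p y k j * fieldCoord u p j y -
      (covDerivCoord v p y).trace * fieldCoord u p k y := by
  have hx := chartPoint_mem hy.1
  rw [fieldCoord, yanoField, coordComp_sub, coordComp_smul, coordComp_covDeriv hU hv p hy.2 hx,
    trace_covDeriv hU hv p hy.2 hx, extChartAt_chartPoint hy.1]
  rfl

theorem contDiffOn_covDerivCoord (hU : IsOpen U) (hu : SmoothCoordOn u U) (p : M) (k j : Fin n) :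
    ContDiffOn ℝ ∞ (fun y => covDerivCoord u p y k j)
      ((extChartAt (𝓡 n) p).target ∩ chartPoint p ⁻¹' U) :=
  contDiffOn_localCov (isOpen_preimage_chartPoint p hU)
    (fun k i j => (contDiffOn_christoffel p k i j).mono Set.inter_subset_left) (hu p) k j

theorem SmoothCoordOn.yanoField (hU : IsOpen U) (hu : SmoothCoordOn u U)
    (hv : SmoothCoordOn v U) : SmoothCoordOn (yanoField u v) U := by
  intro p k
  have h := contDiffOn_covDerivCoord hU hv p
  refine ContDiffOn.congr ?_ fun y hy => fieldCoord_yanoField hU hv p hy k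
  exact (ContDiffOn.sum fun j _ => (h k j).mul (hu p j)).sub
    ((ContDiffOn.sum fun l _ => h l l).mul (hu p k))

/-- The chart at `p` appears only in the Ricci term, since traces of covariant derivatives are
already known to be intrinsic. Two independent fields on an open set are allowed so that the whole
bilinear form can be recovered from the identity. -/
theorem trace_covDeriv_yanoField_chart (hU : IsOpen U) (hu : SmoothCoordOn u U)
    (hv : SmoothCoordOn v U) (p : M) {x : M} (hxU : x ∈ U)
    (hp : x ∈ (chartAt (Model n) p).source) :
    LinearMap.trace ℝ _ (covDeriv (yanoField u v) x) =
      LinearMap.trace ℝ _ (covDeriv u x ∘ₗ covDeriv v x) -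
      LinearMap.trace ℝ _ (covDeriv u x) * LinearMap.trace ℝ _ (covDeriv v x) +
      ∑ j, ∑ k, ricciCoord p (extChartAt (𝓡 n) p x) j k *
        (coordComp p j x (u x) * coordComp p k x (v x)) := by
  rw [trace_covDeriv hU (hu.yanoField hU hv) p hxU hp, trace_covDeriv_comp hU hu hv p hxU hp,
    trace_covDeriv hU hu p hxU hp, trace_covDeriv hU hv p hxU hp]
  have h := localCov_bochner (Γ := christoffel p) (y := extChartAt (𝓡 n) p x)
    (u := fieldCoord u p) (v := fieldCoord v p) (X := fieldCoord (yanoField u v) p)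
    (fun k i j => ((contDiffOn_christoffel p k i j).contDiffAt
      ((isOpen_extChartAt_target p).mem_nhds (extChartAt_mem hp))).differentiableAt (by simp))
    (fun k i j => Eventually.of_forall fun z => christoffel_symm p k i j z)
    (hu.differentiableAt hU p hxU hp)
    (fun i => ((hv p i).contDiffAt (mem_chart_nhds hU p hxU hp)).of_le ENat.LEInfty.out)
    (fun k => by
      filter_upwards [mem_chart_nhds hU p hxU hp] with z hz using fieldCoord_yanoField hU hv p hz k)
  simpa only [fieldCoord_extChartAt _ p hp] using! h

/-- The Ricci tensor in an arbitrary chart. -/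
theorem inner_ricci (p : M) {x : M} (hp : x ∈ (chartAt (Model n) p).source)
    (v w : TangentSpace (𝓡 n) x) :
    inner ℝ (ricci x v) w = ∑ j, ∑ k, ricciCoord p (extChartAt (𝓡 n) p x) j k *
        (coordComp p j x w * coordComp p k x v) := by
  -- Each vector is extended with constant coefficients in the coordinate frame. Such a field is
  -- smooth only on the domain of the chart, which is why the identities above are stated over an
  -- open set.
  have hext : ∀ v : TangentSpace (𝓡 n) x, ∃ V : ∀ z : M, TangentSpace (𝓡 n) z,
      SmoothCoordOn V (chartAt (Model n) p).source ∧ V x = v := by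
    intro v
    refine ⟨fun z => ∑ i, coordComp p i x v • coordField p i z,
      smoothCoordOn_of_contMDiffOn (chartAt (Model n) p).open_source ?_, ?_⟩
    · exact ContMDiffOn.sum_section fun i _ =>
        (contMDiffOn_coordField p i).const_smul_section
    · simp only [coordComp_eq p hp, coordField_eq p hp]
      exact (frame p hp).sum_repr v
  obtain ⟨V, hV, rfl⟩ := hext v
  obtain ⟨W, hW, rfl⟩ := hext w
  -- The same identity is written in the charts at `p` and at `x`. All terms but the Ricci
  -- contractions coincide, so these coincide as well.
  have h1 := trace_covDeriv_yanoField_chart (chartAt (Model n) p).open_source hW hV p hp hp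
  have h2 := trace_covDeriv_yanoField_chart (chartAt (Model n) p).open_source hW hV x hp
    (mem_chart_source (Model n) x)
  rw [inner_ricci_self_chart]
  linarith

/-- Yano's divergence identity. -/
theorem trace_covDeriv_yanoField (hu : SmoothCoordOn u Set.univ) (x : M) :
    LinearMap.trace ℝ _ (covDeriv (yanoField u u) x) =
      LinearMap.trace ℝ _ (covDeriv u x ∘ₗ covDeriv u x) -
      LinearMap.trace ℝ _ (covDeriv u x) ^ 2 + inner ℝ (ricci x (u x)) (u x) := by
  rw [trace_covDeriv_yanoField_chart isOpen_univ hu hu x (Set.mem_univ x)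
    (mem_chart_source (Model n) x), inner_ricci_self_chart, sq]

end Bochner

/-! ### The Riemannian measure -/

section RiemannianMeasure

variable {n : ℕ} {M : Type*} [TopologicalSpace M] [ChartedSpace (Model n) M]
  [IsManifold (𝓡 n) ∞ M] [RiemannianBundle (fun x : M => TangentSpace (𝓡 n) x)]

/-- The density of the Riemannian measure in the chart at `p`. -/
def density (p : M) (y : Model n) : ℝ := Real.sqrt (metricCoord p y).det

theorem density_pos (p : M) {y : Model n} (hy : y ∈ (extChartAt (𝓡 n) p).target) :
    0 < density p y := Real.sqrt_pos.2 (metricCoord_det_pos p hy)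

/-- The metric matrices are congruent through the Jacobian `J`, so their determinants differ by
`(det J)²`, whose square root is `|det J|`. -/
theorem density_transition {p q : M} {z : Model n}
    (hp : z ∈ (extChartAt (𝓡 n) p).target) (hq : chartPoint p z ∈ (chartAt (Model n) q).source) :
    density p z = |(fderiv ℝ (transition p q) z).det| * density q (transition p q z) := by
  set J := LinearMap.toMatrix (stdBasis n) (stdBasis n)
    (fderiv ℝ (transition p q) z : Model n →ₗ[ℝ] Model n) with hJ
  have hJv : ∀ a : Fin n → ℝ, (fderiv ℝ (transition p q) z (WithLp.toLp 2 a)).ofLp =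
      J.mulVec a := fun a =>
    (LinearMap.toMatrix_mulVec_repr (stdBasis n) (stdBasis n)
      (fderiv ℝ (transition p q) z : Model n →ₗ[ℝ] Model n) (WithLp.toLp 2 a)).symm
  have h : metricCoord p z = J.transpose * metricCoord q (transition p q z) * J := by
    refine Matrix.ext_of_mulVec_single fun i => ?_
    refine dotProduct_eq _ _ fun w => ?_
    have := bil_metricCoord_transition hp hq (WithLp.toLp 2 w) (WithLp.toLp 2 (Pi.single i 1))
    rw [hJv, hJv, bil_eq_dotProduct, bil_eq_dotProduct] at this
    rw [dotProduct_comm, dotProduct_comm _ w, ← Matrix.mulVec_mulVec, ← Matrix.mulVec_mulVec]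
    refine this.trans ?_
    rw [Matrix.dotProduct_mulVec w, Matrix.vecMul_transpose]
  have hdet : J.det = (fderiv ℝ (transition p q) z).det := LinearMap.det_toMatrix _ _
  rw [density, h, Matrix.det_mul, Matrix.det_mul, Matrix.det_transpose, hdet, density,
    mul_right_comm, ← sq, Real.sqrt_mul (sq_nonneg _), Real.sqrt_sq_eq_abs]

theorem contDiffOn_density [IsContMDiffRiemannianBundle (𝓡 n) ∞ (Model n)
    (fun x : M => TangentSpace (𝓡 n) x)] (p : M) :
    ContDiffOn ℝ ∞ (density p) (extChartAt (𝓡 n) p).target :=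
  (contDiffOn_det (contDiffOn_metricCoord p)).sqrt fun _ hz => (metricCoord_det_pos p hz).ne'

variable [MeasurableSpace M] [BorelSpace M]

omit [IsManifold (𝓡 n) ∞ M] [RiemannianBundle (fun x : M => TangentSpace (𝓡 n) x)] in
theorem aemeasurable_chartPoint (p : M) : AEMeasurable (chartPoint (n := n) p)
    (volume.restrict (extChartAt (𝓡 n) p).target) :=
  (continuousOn_chartPoint p).aemeasurable (isOpen_extChartAt_target p).measurableSet

omit [IsManifold (𝓡 n) ∞ M] [RiemannianBundle (fun x : M => TangentSpace (𝓡 n) x)] in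
theorem measurableSet_chart_preimage (p : M) {A : Set M} (hA : MeasurableSet A) :
    MeasurableSet (chartPoint p ⁻¹' A ∩ (extChartAt (𝓡 n) p).target) := by
  have h1 : Measurable ((extChartAt (𝓡 n) p).target.domRestrict (chartPoint p)) :=
    (continuousOn_iff_continuous_domRestrict.1 (continuousOn_chartPoint p)).measurable
  have h2 := (isOpen_extChartAt_target (I := 𝓡 n) p).measurableSet.subtype_image (h1 hA)
  convert h2 using 1
  ext y
  constructor
  · rintro ⟨h, hy⟩
    exact ⟨⟨y, hy⟩, h, rfl⟩
  · rintro ⟨⟨z, hz⟩, h, rfl⟩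
    exact ⟨h, hz⟩

theorem chartMeasure_apply (p : M) {A : Set M} (hA : MeasurableSet A) :
    chartMeasure (n := n) p A = ∫⁻ y in chartPoint p ⁻¹' A ∩ (extChartAt (𝓡 n) p).target,
      ENNReal.ofReal (density p y) := by
  rw [chartMeasure, Measure.map_apply_of_aemeasurable _ hA, withDensity_apply',
    Measure.restrict_restrict' (isOpen_extChartAt_target p).measurableSet]
  · rfl
  · exact (aemeasurable_chartPoint p).mono_ac (withDensity_absolutelyContinuous _ _)

theorem chartMeasure_inter_source (p : M) {A : Set M} (hA : MeasurableSet A) :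
    chartMeasure (n := n) p (A ∩ (chartAt (Model n) p).source) = chartMeasure (n := n) p A := by
  rw [chartMeasure_apply p hA,
    chartMeasure_apply p (hA.inter (chartAt (Model n) p).open_source.measurableSet)]
  congr 2
  ext y
  exact ⟨fun h => ⟨h.1.1, h.2⟩, fun h => ⟨⟨h.1, chartPoint_mem h.2⟩, h.2⟩⟩

/-- This is the change of variables formula for the transition map: its Jacobian factor is absorbed
by `density_transition`. -/
theorem chartMeasure_eq_of_subset {p q : M} {A : Set M} (hA : MeasurableSet A)
    (hp : A ⊆ (chartAt (Model n) p).source) (hq : A ⊆ (chartAt (Model n) q).source) :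
    chartMeasure (n := n) p A = chartMeasure (n := n) q A := by
  rw [chartMeasure_apply p hA, chartMeasure_apply q hA]
  set S := chartPoint p ⁻¹' A ∩ (extChartAt (𝓡 n) p).target with hS
  have himg : chartPoint q ⁻¹' A ∩ (extChartAt (𝓡 n) q).target = transition p q '' S := by
    ext y
    constructor
    · rintro ⟨h1, h2⟩
      refine ⟨extChartAt (𝓡 n) p (chartPoint q y), ⟨?_, extChartAt_mem (hp h1)⟩, ?_⟩
      · rwa [Set.mem_preimage, chartPoint_extChartAt (hp h1)]
      · rw [transition, chartPoint_extChartAt (hp h1), extChartAt_chartPoint h2]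
    · rintro ⟨z, ⟨h1, h2⟩, rfl⟩
      refine ⟨?_, extChartAt_mem (hq h1)⟩
      rwa [Set.mem_preimage, transition, chartPoint_extChartAt (hq h1)]
  rw [himg, lintegral_image_eq_lintegral_abs_det_fderiv_mul volume
    (measurableSet_chart_preimage p hA) (f' := fderiv ℝ (transition p q))]
  · refine setLIntegral_congr_fun (measurableSet_chart_preimage p hA) fun z hz => ?_
    rw [← ENNReal.ofReal_mul (abs_nonneg _), ← density_transition hz.2 (hq hz.1)]
  · intro z hz
    have := (contDiffAt_transition (hp hz.1) (hq hz.1)).differentiableAt (by simp)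
    rw [extChartAt_chartPoint hz.2] at this
    exact this.hasFDerivAt.hasFDerivWithinAt
  · intro z hz w hw h
    have h1 := congrArg (chartPoint q) h
    rw [transition, transition, chartPoint_extChartAt (hq hz.1), chartPoint_extChartAt (hq hw.1)] at h1
    rw [← extChartAt_chartPoint hz.2, h1, extChartAt_chartPoint hw.2]

/-- The Riemannian measure restricts to the measures given by the charts. -/
theorem riemannianMeasure_eq_chartMeasure [CompactSpace M] (p : M) {A : Set M}
    (hA : MeasurableSet A) (hp : A ⊆ (chartAt (Model n) p).source) :
    riemannianMeasure n M A = chartMeasure (n := n) p A := by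
  obtain ⟨t, ht⟩ := CompactSpace.elim_nhds_subcover (fun x : M => (chartAt (Model n) x).source)
    fun x => (chartAt (Model n) x).open_source.mem_nhds (mem_chart_source _ x)
  let e := t.equivFin.symm
  let S : Fin t.card → Set M := fun i => (chartAt (Model n) (e i : M)).source
  have hSU : ⋃ i, disjointed S i = Set.univ := by
    rw [iUnion_disjointed, Set.eq_univ_iff_forall]
    intro x
    have hx : x ∈ ⋃ y ∈ t, (chartAt (Model n) y).source := by rw [ht]; trivial
    obtain ⟨y, hy, hxy⟩ := Set.mem_iUnion₂.1 hx
    exact Set.mem_iUnion.2 ⟨e.symm ⟨y, hy⟩, by simpa [S] using hxy⟩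
  have hSm : ∀ i, MeasurableSet (disjointed S i) := fun i =>
    (chartAt (Model n) _).open_source.measurableSet.diff (by
      rw [Finset.sup_set_eq_biUnion]
      exact Finset.measurableSet_biUnion _ fun j _ =>
        (chartAt (Model n) _).open_source.measurableSet)
  -- A finite chart cover is made disjoint and the chart measures are glued along it. The resulting
  -- `ν` is a concrete measure that restricts correctly to every chart.
  let ν : Measure M := Measure.sum fun i => (chartMeasure (n := n) (e i : M)).restrict
    (disjointed S i)
  have hν : ∀ (p : M) (A : Set M), MeasurableSet A → A ⊆ (chartAt (Model n) p).source →
      ν A = chartMeasure (n := n) p A := by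
    intro p A hA hp
    have h1 : chartMeasure (n := n) p = Measure.sum fun i =>
        (chartMeasure (n := n) p).restrict (disjointed S i) := by
      rw [← Measure.restrict_iUnion (disjoint_disjointed S) hSm, hSU, Measure.restrict_univ]
    rw [h1, Measure.sum_apply _ hA, Measure.sum_apply _ hA]
    congr 1
    ext i
    rw [Measure.restrict_apply hA, Measure.restrict_apply hA]
    exact chartMeasure_eq_of_subset (hA.inter (hSm i))
      (Set.inter_subset_right.trans (disjointed_le S i)) (Set.inter_subset_left.trans hp)
  -- The supremum dominates each chart measure. Conversely `ν` bounds every chart measure, hence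
  -- their supremum, and it has the right value on `A`.
  refine le_antisymm ?_ (Measure.le_iff'.1 (le_iSup (fun p : M => chartMeasure (n := n) p) p) A)
  rw [← hν p A hA hp]
  refine Measure.le_iff'.1 (iSup_le fun q => Measure.le_iff.2 fun B hB => ?_) A
  rw [← chartMeasure_inter_source q hB, ← hν q _
    (hB.inter (chartAt (Model n) q).open_source.measurableSet) Set.inter_subset_right]
  exact measure_mono Set.inter_subset_left

theorem restrict_riemannianMeasure [CompactSpace M] (p : M) :
    (riemannianMeasure n M).restrict (chartAt (Model n) p).source = chartMeasure (n := n) p := by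
  ext A hA
  rw [Measure.restrict_apply hA, riemannianMeasure_eq_chartMeasure p
    (hA.inter (chartAt (Model n) p).open_source.measurableSet) Set.inter_subset_right,
    chartMeasure_inter_source p hA]

variable [CompactSpace M] [IsContMDiffRiemannianBundle (𝓡 n) ∞ (Model n)
    (fun x : M => TangentSpace (𝓡 n) x)]

theorem integral_riemannianMeasure_eq (p : M) {f : M → ℝ}
    (hf : AEStronglyMeasurable f (riemannianMeasure n M))
    (hs : Function.support f ⊆ (chartAt (Model n) p).source) :
    ∫ x, f x ∂(riemannianMeasure n M) =
      ∫ y in (extChartAt (𝓡 n) p).target, density p y * f (chartPoint p y) := by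
  have hm := (isOpen_extChartAt_target (I := 𝓡 n) p).measurableSet
  have hd : AEMeasurable (fun y => ENNReal.ofReal (density p y))
      (volume.restrict (extChartAt (𝓡 n) p).target) :=
    ((contDiffOn_density p).continuousOn.aemeasurable hm).ennreal_ofReal
  have hf' : AEStronglyMeasurable f (chartMeasure (n := n) p) := by
    rw [← restrict_riemannianMeasure]; exact hf.restrict
  rw [← setIntegral_eq_integral_of_forall_compl_eq_zero
    (s := (chartAt (Model n) p).source) fun x hx => by
      by_contra h; exact hx (hs h), restrict_riemannianMeasure]
  rw [chartMeasure] at hf' ⊢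
  rw [integral_map ((aemeasurable_chartPoint p).mono_ac (withDensity_absolutelyContinuous _ _)) hf']
  refine (integral_withDensity_eq_integral_toReal_smul₀ hd
    (Eventually.of_forall fun _ => ENNReal.ofReal_lt_top) _).trans ?_
  refine setIntegral_congr_fun hm fun y hy => ?_
  simp only [smul_eq_mul]
  rw [ENNReal.toReal_ofReal (density_pos p hy).le]

/-- An open set meets some chart in a nonempty open set of coordinates, where the density is
positive. The vanishing theorem uses this to pass from integrals to pointwise values. -/
instance isOpenPosMeasure_riemannianMeasure : (riemannianMeasure n M).IsOpenPosMeasure := by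
  refine ⟨fun U hU ⟨x, hx⟩ h0 => ?_⟩
  have h1 : chartMeasure (n := n) x U = 0 := by
    rw [← restrict_riemannianMeasure]
    exact le_antisymm ((Measure.restrict_apply_le _ _).trans h0.le) zero_le
  have hm := (isOpen_extChartAt_target (I := 𝓡 n) x).measurableSet
  rw [chartMeasure_apply x hU.measurableSet] at h1
  have hd : AEMeasurable (fun y => ENNReal.ofReal (density x y))
      (volume.restrict (extChartAt (𝓡 n) x).target) :=
    ((contDiffOn_density x).continuousOn.aemeasurable hm).ennreal_ofReal
  rw [← Measure.restrict_restrict' hm, ← withDensity_apply', withDensity_apply_eq_zero' hd,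
    Measure.restrict_apply' hm] at h1
  have hopen := isOpen_preimage_chartPoint (n := n) x hU
  refine (hopen.measure_pos volume ⟨extChartAt (𝓡 n) x x, extChartAt_mem (mem_chart_source _ x),
    ?_⟩).ne' (measure_mono_null ?_ h1)
  · rwa [Set.mem_preimage, chartPoint_extChartAt (mem_chart_source _ x)]
  · rintro y ⟨hy1, hy2⟩
    exact ⟨⟨by simpa using density_pos x hy1, hy2⟩, hy1⟩

instance isFiniteMeasure_riemannianMeasure : IsFiniteMeasure (riemannianMeasure n M) := by
  have : IsLocallyFiniteMeasure (riemannianMeasure n M) := by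
    refine ⟨fun x => ?_⟩
    have hx := mem_chart_source (Model n) x
    have hcont : ContinuousAt (density x) (extChartAt (𝓡 n) x x) :=
      (contDiffOn_density x).continuousOn.continuousAt
        ((isOpen_extChartAt_target x).mem_nhds (extChartAt_mem hx))
    -- By continuity the density stays below its central value plus one on a coordinate ball, so the
    -- ball has finite measure. Compactness does the rest.
    have h1 : ∀ᶠ y in 𝓝 (extChartAt (𝓡 n) x x), density x y < density x (extChartAt (𝓡 n) x x) + 1 :=
      hcont.eventually_lt continuousAt_const (by linarith)
    obtain ⟨r, hr, hrb⟩ := Metric.eventually_nhds_iff_ball.1 h1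
    let N : Set M := (chartAt (Model n) x).source ∩
      extChartAt (𝓡 n) x ⁻¹' Metric.ball (extChartAt (𝓡 n) x x) r
    have hN : IsOpen N := by
      have := (continuousOn_extChartAt (I := 𝓡 n) x)
      rw [extChartAt_source] at this
      exact this.isOpen_inter_preimage (chartAt (Model n) x).open_source Metric.isOpen_ball
    refine ⟨N, hN.mem_nhds ⟨hx, Metric.mem_ball_self hr⟩, ?_⟩
    rw [riemannianMeasure_eq_chartMeasure x hN.measurableSet Set.inter_subset_left,
      chartMeasure_apply x hN.measurableSet]
    have hsub : chartPoint x ⁻¹' N ∩ (extChartAt (𝓡 n) x).target ⊆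
        Metric.ball (extChartAt (𝓡 n) x x) r := by
      rintro y ⟨hy1, hy2⟩
      have := hy1.2
      rwa [Set.mem_preimage, extChartAt_chartPoint hy2] at this
    calc ∫⁻ y in chartPoint x ⁻¹' N ∩ (extChartAt (𝓡 n) x).target, ENNReal.ofReal (density x y)
        ≤ ∫⁻ _ in chartPoint x ⁻¹' N ∩ (extChartAt (𝓡 n) x).target,
          ENNReal.ofReal (density x (extChartAt (𝓡 n) x x) + 1) :=
          setLIntegral_mono measurable_const fun y hy =>
            ENNReal.ofReal_le_ofReal (hrb y (hsub hy)).le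
      _ ≤ ENNReal.ofReal (density x (extChartAt (𝓡 n) x x) + 1) *
          volume (Metric.ball (extChartAt (𝓡 n) x x) r) := by
          rw [setLIntegral_const]
          gcongr
      _ < ⊤ := ENNReal.mul_lt_top ENNReal.ofReal_lt_top measure_ball_lt_top
  infer_instance

end RiemannianMeasure

/-! ### The divergence theorem -/

theorem integral_partialDeriv_eq_zero {n : ℕ} {h : Model n → ℝ} (hh : ContDiff ℝ ∞ h)
    (hc : HasCompactSupport h) (k : Fin n) : ∫ y, partialDeriv k h y = 0 := by
  have h1 : Integrable h := hh.continuous.integrable_of_hasCompactSupport hc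
  have h2 : Continuous fun y => fderiv ℝ h y (stdBasis n k) :=
    (hh.continuous_fderiv (by simp)).clm_apply continuous_const
  have h3 : Integrable fun y => fderiv ℝ h y (stdBasis n k) :=
    h2.integrable_of_hasCompactSupport (hc.fderiv_apply ℝ _)
  -- Integration by parts against the constant function `1`.
  have := integral_mul_fderiv_eq_neg_fderiv_mul_of_integrable (μ := volume)
    (f := fun _ : Model n => (1 : ℝ)) (g := h) (v := stdBasis n k)
    (by simp) (by simpa using h3) (by simpa using h1)
    (fun _ _ => differentiableAt_const _) (fun y _ => hh.differentiable (by simp) y)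
  simpa [partialDeriv] using this

section Divergence

variable {n : ℕ} {M : Type*} [TopologicalSpace M] [ChartedSpace (Model n) M]

/-- Quantities such as `tr ∇u` are defined with a chart that varies with the point. Continuity at
`p` is checked on a formula in the fixed chart at `p`, which is what chart independence provides. -/
theorem continuous_of_chart {f : M → ℝ} (F : M → Model n → ℝ)
    (hF : ∀ p, ContinuousOn (F p) (extChartAt (𝓡 n) p).target)
    (h : ∀ p, ∀ x ∈ (chartAt (Model n) p).source, f x = F p (extChartAt (𝓡 n) p x)) :
    Continuous f := by
  refine continuous_iff_continuousAt.2 fun p => ?_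
  have hp := (chartAt (Model n) p).open_source.mem_nhds (mem_chart_source (Model n) p)
  have h1 : ContinuousAt (fun x => F p (extChartAt (𝓡 n) p x)) p :=
    ((hF p).continuousAt ((isOpen_extChartAt_target p).mem_nhds
      (extChartAt_mem (mem_chart_source _ p)))).comp (continuousAt_extChartAt p)
  exact h1.congr (by filter_upwards [hp] with x hx using (h p x hx).symm)

variable [IsManifold (𝓡 n) ∞ M]

theorem fieldCoord_sum {ι : Type*} (s : Finset ι) (X : ι → ∀ x : M, TangentSpace (𝓡 n) x) (p : M)
    (k : Fin n) (y : Model n) : fieldCoord (fun x => ∑ i ∈ s, X i x) p k y =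
      ∑ i ∈ s, fieldCoord (X i) p k y := map_sum _ _ _

theorem fieldCoord_smul (ρ : M → ℝ) (X : ∀ x : M, TangentSpace (𝓡 n) x) (p : M) (k : Fin n)
    (y : Model n) : fieldCoord (fun x => ρ x • X x) p k y =
      ρ (chartPoint p y) * fieldCoord X p k y := map_smul _ _ _

theorem SmoothCoordOn.smul {ρ : M → ℝ} (hρ : ContMDiff (𝓡 n) 𝓘(ℝ, ℝ) ∞ ρ)
    {X : ∀ x : M, TangentSpace (𝓡 n) x} {U : Set M} (hX : SmoothCoordOn X U) :
    SmoothCoordOn (fun x => ρ x • X x) U := by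
  intro p k
  exact ((contDiffOn_comp_chartPoint p hρ.contMDiffOn).mul (hX p k)).congr
    fun y _ => fieldCoord_smul ρ X p k y

variable [RiemannianBundle (fun x : M => TangentSpace (𝓡 n) x)]

theorem trace_covDeriv_sum {ι : Type*} (s : Finset ι) {X : ι → ∀ x : M, TangentSpace (𝓡 n) x}
    (hX : ∀ i, SmoothCoordOn (X i) Set.univ) (x : M) :
    LinearMap.trace ℝ _ (covDeriv (fun x => ∑ i ∈ s, X i x) x) =
      ∑ i ∈ s, LinearMap.trace ℝ _ (covDeriv (X i) x) := by
  have hx := mem_chart_source (Model n) x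
  have ht : ∀ X : ∀ x : M, TangentSpace (𝓡 n) x, LinearMap.trace ℝ _ (covDeriv X x) =
      (covDerivCoord X x (extChartAt (𝓡 n) x x)).trace := by
    intro X
    rw [LinearMap.trace_eq_matrix_trace ℝ (tangentBasis x), covDeriv, LinearMap.toMatrix_toLin]
  have hd : ∀ k, partialDeriv k (fieldCoord (fun x => ∑ i ∈ s, X i x) x k)
      (extChartAt (𝓡 n) x x) =
      ∑ i ∈ s, partialDeriv k (fieldCoord (X i) x k) (extChartAt (𝓡 n) x x) := by
    intro k
    have : fieldCoord (fun x => ∑ i ∈ s, X i x) x k =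
      fun y => ∑ i ∈ s, fieldCoord (X i) x k y := funext fun y => fieldCoord_sum s X x k y
    rw [this, partialDeriv, fderiv_fun_sum fun i _ =>
      (hX i).differentiableAt isOpen_univ x (Set.mem_univ x) hx k]
    simp [partialDeriv]
  simp only [ht, Matrix.trace, Matrix.diag, covDerivCoord, Matrix.of_apply, hd, fieldCoord_sum,
    Finset.mul_sum]
  rw [Finset.sum_comm]
  refine Finset.sum_congr rfl fun k _ => ?_
  rw [Finset.sum_add_distrib]
  congr 1
  rw [Finset.sum_comm]

theorem covDeriv_eq_zero_of_eventuallyEq {X : ∀ x : M, TangentSpace (𝓡 n) x} {x : M}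
    (h : ∀ᶠ z in 𝓝 x, X z = 0) : covDeriv X x = 0 := by
  have hx := mem_chart_source (Model n) x
  have hev : ∀ k, fieldCoord X x k =ᶠ[𝓝 (extChartAt (𝓡 n) x x)] 0 := by
    intro k
    have hc : ContinuousAt (chartPoint x) (extChartAt (𝓡 n) x x) :=
      (continuousOn_chartPoint x).continuousAt
        ((isOpen_extChartAt_target x).mem_nhds (extChartAt_mem hx))
    have h' : ∀ᶠ z in 𝓝 (chartPoint x (extChartAt (𝓡 n) x x)), X z = 0 := by
      rwa [chartPoint_extChartAt hx]
    filter_upwards [hc.eventually h'] with y hy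
    rw [fieldCoord, hy]
    exact map_zero _
  have : covDerivCoord X x (extChartAt (𝓡 n) x x) = 0 := by
    ext k j
    simp only [covDerivCoord, Matrix.of_apply, partialDeriv, (hev _).fderiv_eq,
      (hev _).self_of_nhds]
    simp
  rw [covDeriv, this, map_zero]

variable [IsContMDiffRiemannianBundle (𝓡 n) ∞ (Model n) (fun x : M => TangentSpace (𝓡 n) x)]

theorem continuous_trace_covDeriv {X : ∀ x : M, TangentSpace (𝓡 n) x}
    (hX : SmoothCoordOn X Set.univ) :
    Continuous fun x => LinearMap.trace ℝ _ (covDeriv X x) := by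
  refine continuous_of_chart (fun p y => (covDerivCoord X p y).trace) (fun p => ?_)
    fun p x hx => trace_covDeriv isOpen_univ hX p (Set.mem_univ x) hx
  have h := contDiffOn_covDerivCoord isOpen_univ hX p
  simp only [Set.preimage_univ, Set.inter_univ] at h
  exact (ContDiffOn.sum (s := Finset.univ) fun l _ => h l l).continuousOn

variable [CompactSpace M] [MeasurableSpace M] [BorelSpace M]

/-- In the chart, density times divergence is a sum of partial derivatives of compactly supported
smooth functions, each of which has integral zero. -/
theorem integral_trace_covDeriv_of_tsupport {X : ∀ x : M, TangentSpace (𝓡 n) x}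
    (hX : SmoothCoordOn X Set.univ) {ρ : M → ℝ} (hρ : ContMDiff (𝓡 n) 𝓘(ℝ, ℝ) ∞ ρ) {p : M}
    (hp : tsupport ρ ⊆ (chartAt (Model n) p).source) :
    ∫ x, LinearMap.trace ℝ _ (covDeriv (fun x => ρ x • X x) x) ∂(riemannianMeasure n M) = 0 := by
  set Y : ∀ x : M, TangentSpace (𝓡 n) x := fun x => ρ x • X x with hYdef
  have hY : SmoothCoordOn Y Set.univ := hX.smul hρ
  have htop := isOpen_extChartAt_target (I := 𝓡 n) p
  have hYc : ∀ k, ContDiffOn ℝ ∞ (fieldCoord Y p k) (extChartAt (𝓡 n) p).target := fun k => by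
    simpa only [Set.preimage_univ, Set.inter_univ] using hY p k
  rw [integral_riemannianMeasure_eq p (continuous_trace_covDeriv hY).aestronglyMeasurable]
  · -- the compactly supported functions whose derivatives are integrated
    let K : Set (Model n) := extChartAt (𝓡 n) p '' tsupport ρ
    have hK : IsCompact K := (isClosed_tsupport ρ).isCompact.image_of_continuousOn
      ((continuousOn_extChartAt p).mono (by rwa [extChartAt_source]))
    let h : Fin n → Model n → ℝ := fun k => (extChartAt (𝓡 n) p).target.indicator
      fun y => density p y * fieldCoord Y p k y
    have hzero : ∀ k, ∀ y ∉ K, h k y = 0 := by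
      intro k y hy
      by_cases hyt : y ∈ (extChartAt (𝓡 n) p).target
      · have : ρ (chartPoint p y) = 0 := by
          by_contra h0
          exact hy ⟨_, subset_tsupport _ h0, extChartAt_chartPoint hyt⟩
        simp only [h, Set.indicator_of_mem hyt, Y, fieldCoord_smul, this, zero_mul, mul_zero]
      · exact Set.indicator_of_notMem hyt _
    have hKt : K ⊆ (extChartAt (𝓡 n) p).target := by
      rintro _ ⟨x, hx, rfl⟩
      exact extChartAt_mem (hp hx)
    have hevt : ∀ k, ∀ y ∈ (extChartAt (𝓡 n) p).target,
        h k =ᶠ[𝓝 y] fun y => density p y * fieldCoord Y p k y := by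
      intro k y hy
      filter_upwards [htop.mem_nhds hy] with z hz using Set.indicator_of_mem hz _
    have hev0 : ∀ k, ∀ y ∉ K, h k =ᶠ[𝓝 y] 0 := by
      intro k y hy
      filter_upwards [hK.isClosed.isOpen_compl.mem_nhds hy] with z hz using hzero k z hz
    -- The target of the chart and the complement of `K` are open and cover the space. On the first
    -- `h k` is a product of smooth functions, on the second it vanishes.
    have hsm : ∀ k, ContDiff ℝ ∞ (h k) := by
      intro k
      refine contDiff_iff_contDiffAt.2 fun y => ?_
      by_cases hy : y ∈ (extChartAt (𝓡 n) p).target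
      · exact (((contDiffOn_density p).mul (hYc k)).contDiffAt (htop.mem_nhds hy)).congr_of_eventuallyEq
          (hevt k y hy)
      · exact contDiffAt_const.congr_of_eventuallyEq (hev0 k y fun h => hy (hKt h))
    have hcs : ∀ k, HasCompactSupport (h k) := fun k =>
      HasCompactSupport.intro hK fun y hy => hzero k y hy
    have hint : ∀ k, Integrable (partialDeriv k (h k)) := fun k =>
      (((hsm k).continuous_fderiv (by simp)).clm_apply
        continuous_const).integrable_of_hasCompactSupport ((hcs k).fderiv_apply ℝ _)
    have hcongr : ∫ y in (extChartAt (𝓡 n) p).target, density p y *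
        LinearMap.trace ℝ _ (covDeriv Y (chartPoint p y)) =
        ∫ y in (extChartAt (𝓡 n) p).target, ∑ k, partialDeriv k (h k) y := by
      refine setIntegral_congr_fun htop.measurableSet fun y hy => ?_
      rw [trace_covDeriv isOpen_univ hY p (Set.mem_univ _) (chartPoint_mem hy),
        extChartAt_chartPoint hy]
      refine (sqrt_det_mul_trace_localCov htop (contDiffOn_metricCoord p)
        (fun z _ => metricCoord_isSymm p z) (fun z hz => metricCoord_det_pos p hz) hy
        (X := fieldCoord Y p)
        (fun i => ((hYc i).contDiffAt (htop.mem_nhds hy)).differentiableAt (by simp))).trans ?_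
      refine Finset.sum_congr rfl fun k _ => ?_
      rw [partialDeriv, partialDeriv, (hevt k y hy).fderiv_eq]
      rfl
    rw [hcongr, setIntegral_eq_integral_of_forall_compl_eq_zero, integral_finsetSum _ fun k _ => hint k]
    · exact Finset.sum_eq_zero fun k _ => integral_partialDeriv_eq_zero (hsm k) (hcs k) k
    · intro y hy
      refine Finset.sum_eq_zero fun k _ => ?_
      rw [partialDeriv, (hev0 k y fun h => hy (hKt h)).fderiv_eq]
      simp
  · intro x hx
    by_contra hxs
    refine hx ?_
    have : covDeriv Y x = 0 := by
      refine covDeriv_eq_zero_of_eventuallyEq ?_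
      filter_upwards [(isClosed_tsupport ρ).isOpen_compl.mem_nhds fun h => hxs (hp h)] with z hz
      have : ρ z = 0 := image_eq_zero_of_notMem_tsupport hz
      simp only [Y, this, zero_smul]
    simp only [this, map_zero]

/-- The divergence theorem. -/
theorem integral_trace_covDeriv [T2Space M] {X : ∀ x : M, TangentSpace (𝓡 n) x}
    (hX : SmoothCoordOn X Set.univ) :
    ∫ x, LinearMap.trace ℝ _ (covDeriv X x) ∂(riemannianMeasure n M) = 0 := by
  obtain ⟨t, ht⟩ := CompactSpace.elim_nhds_subcover (fun x : M => (chartAt (Model n) x).source)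
    fun x => (chartAt (Model n) x).open_source.mem_nhds (mem_chart_source _ x)
  obtain ⟨f, hf⟩ := SmoothPartitionOfUnity.exists_isSubordinate (𝓡 n) isClosed_univ
    (fun i : t => (chartAt (Model n) (i : M)).source)
    (fun i => (chartAt (Model n) (i : M)).open_source) (by
      intro x _
      have hx : x ∈ ⋃ y ∈ t, (chartAt (Model n) y).source := by rw [ht]; trivial
      obtain ⟨y, hy, hxy⟩ := Set.mem_iUnion₂.1 hx
      exact Set.mem_iUnion.2 ⟨⟨y, hy⟩, hxy⟩)
  have hsum : X = fun x => ∑ i, f i x • X x := by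
    ext x
    rw [← Finset.sum_smul, ← finsum_eq_sum_of_fintype, f.sum_eq_one (Set.mem_univ x), one_smul]
  have hs : ∀ i, SmoothCoordOn (fun x => f i x • X x) Set.univ := fun i =>
    hX.smul (f i).contMDiff
  rw [hsum]
  simp only [trace_covDeriv_sum Finset.univ hs]
  rw [integral_finsetSum]
  · exact Finset.sum_eq_zero fun i _ =>
      integral_trace_covDeriv_of_tsupport hX (f i).contMDiff (hf i)
  · exact fun i _ => (continuous_trace_covDeriv (hs i)).integrable_of_hasCompactSupport
      (HasCompactSupport.of_compactSpace _)

end Divergence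

/-! ### Pointwise algebra of the Killing and conformal Killing operators -/

section TensorAlgebra

variable {n : ℕ} {M : Type*} [TopologicalSpace M] [ChartedSpace (Model n) M]
  [IsManifold (𝓡 n) ∞ M] [RiemannianBundle (fun x : M => TangentSpace (𝓡 n) x)] {x : M}

theorem tensorInner_eq_sum {ι : Type*} [Fintype ι]
    (b : OrthonormalBasis ι ℝ (TangentSpace (𝓡 n) x))
    (A B : TangentSpace (𝓡 n) x →ₗ[ℝ] TangentSpace (𝓡 n) x) :
    tensorInner A B = ∑ i, inner ℝ (B (b i)) (A (b i)) := by
  rw [tensorInner, LinearMap.trace_comp_comm', LinearMap.trace_eq_sum_inner _ b]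
  exact Finset.sum_congr rfl fun i _ => by
    rw [LinearMap.comp_apply, LinearMap.adjoint_inner_right]

theorem trace_adjoint_eq (A : TangentSpace (𝓡 n) x →ₗ[ℝ] TangentSpace (𝓡 n) x) :
    LinearMap.trace ℝ _ (LinearMap.adjoint A) = LinearMap.trace ℝ _ A := by
  rw [LinearMap.trace_eq_sum_inner _ (stdOrthonormalBasis ℝ (TangentSpace (𝓡 n) x)),
    LinearMap.trace_eq_sum_inner _ (stdOrthonormalBasis ℝ (TangentSpace (𝓡 n) x))]
  exact Finset.sum_congr rfl fun i _ => by
    rw [LinearMap.adjoint_inner_right, real_inner_comm]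

theorem tensorInner_killingOp (A : TangentSpace (𝓡 n) x →ₗ[ℝ] TangentSpace (𝓡 n) x) :
    tensorInner (killingOp A) (killingOp A) =
      2 * tensorInner A A + 2 * LinearMap.trace ℝ _ (A ∘ₗ A) := by
  have h1 : LinearMap.trace ℝ _ (LinearMap.adjoint A ∘ₗ LinearMap.adjoint A) =
      LinearMap.trace ℝ _ (A ∘ₗ A) := by
    rw [← LinearMap.adjoint_comp, trace_adjoint_eq]
  have h2 : LinearMap.trace ℝ _ (LinearMap.adjoint A ∘ₗ A) =
      LinearMap.trace ℝ _ (A ∘ₗ LinearMap.adjoint A) := LinearMap.trace_comp_comm' _ _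
  simp only [tensorInner, killingOp, map_add, LinearMap.adjoint_adjoint, LinearMap.add_comp,
    LinearMap.comp_add, h1, h2]
  ring

theorem trace_killingOp (A : TangentSpace (𝓡 n) x →ₗ[ℝ] TangentSpace (𝓡 n) x) :
    LinearMap.trace ℝ _ (killingOp A) = 2 * LinearMap.trace ℝ _ A := by
  rw [killingOp, map_add, trace_adjoint_eq, two_mul]

/-- This is Pythagoras: `conformalOp A` is the trace-free part of `killingOp A`, orthogonal to the
identity, whose squared norm is `n`. -/
theorem tensorInner_conformalOp (A : TangentSpace (𝓡 n) x →ₗ[ℝ] TangentSpace (𝓡 n) x) :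
    tensorInner (conformalOp A) (conformalOp A) =
      tensorInner (killingOp A) (killingOp A) - (4 / (n : ℝ)) * LinearMap.trace ℝ _ A ^ 2 := by
  have hS := trace_killingOp A
  have hS' : LinearMap.trace ℝ _ (LinearMap.adjoint (killingOp A)) = 2 * LinearMap.trace ℝ _ A := by
    rw [trace_adjoint_eq, hS]
  have hid : LinearMap.trace ℝ (TangentSpace (𝓡 n) x) LinearMap.id = n := by
    rw [LinearMap.trace_id, Module.finrank_eq_card_basis (tangentBasis x), Fintype.card_fin]
  have hadj : LinearMap.adjoint (LinearMap.id : TangentSpace (𝓡 n) x →ₗ[ℝ] _) = LinearMap.id :=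
    LinearMap.adjoint_id
  simp only [tensorInner, conformalOp, map_sub, LinearMap.sub_comp, LinearMap.comp_sub,
    map_smul, LinearMap.smul_comp, LinearMap.comp_smul, hadj, LinearMap.id_comp, LinearMap.comp_id,
    hS, hS', hid, smul_eq_mul]
  -- In dimension zero division by zero makes both coefficients `2/n` and `4/n` vanish, so the
  -- formula persists.
  rcases eq_or_ne (n : ℝ) 0 with h | h
  · simp [h]
  · field_simp
    ring

/-- The images of an orthonormal basis under a `(1,1)` tensor, whose norm is the norm of the
tensor. -/
def tensorVec : (TangentSpace (𝓡 n) x →ₗ[ℝ] TangentSpace (𝓡 n) x) →ₗ[ℝ]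
    PiLp 2 fun _ : Fin (Module.finrank ℝ (TangentSpace (𝓡 n) x)) => TangentSpace (𝓡 n) x where
  toFun A := WithLp.toLp 2 fun i => A (stdOrthonormalBasis ℝ (TangentSpace (𝓡 n) x) i)
  map_add' _ _ := rfl
  map_smul' _ _ := rfl

theorem norm_tensorVec (A : TangentSpace (𝓡 n) x →ₗ[ℝ] TangentSpace (𝓡 n) x) :
    ‖tensorVec A‖ = Real.sqrt (tensorInner A A) := by
  rw [PiLp.norm_eq_of_L2, tensorInner_eq_sum (stdOrthonormalBasis ℝ (TangentSpace (𝓡 n) x))]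
  simp only [real_inner_self_eq_norm_sq]
  rfl

theorem tensorInner_self_nonneg (A : TangentSpace (𝓡 n) x →ₗ[ℝ] TangentSpace (𝓡 n) x) :
    0 ≤ tensorInner A A := by
  rw [tensorInner_eq_sum (stdOrthonormalBasis ℝ (TangentSpace (𝓡 n) x))]
  exact Finset.sum_nonneg fun i _ => real_inner_self_nonneg

/-- This is the reverse triangle inequality, available because `tensorVec` realises the tensor norm
as the norm of a genuine normed space. -/
theorem abs_sqrt_tensorInner_sub_le (A B : TangentSpace (𝓡 n) x →ₗ[ℝ] TangentSpace (𝓡 n) x) :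
    |Real.sqrt (tensorInner A A) - Real.sqrt (tensorInner B B)| ≤
      Real.sqrt (tensorInner (A - B) (A - B)) := by
  simp only [← norm_tensorVec, map_sub]
  exact abs_norm_sub_norm_le _ _

theorem tensorInner_adjoint (A : TangentSpace (𝓡 n) x →ₗ[ℝ] TangentSpace (𝓡 n) x) :
    tensorInner (LinearMap.adjoint A) (LinearMap.adjoint A) = tensorInner A A := by
  rw [tensorInner, tensorInner, LinearMap.adjoint_adjoint, LinearMap.trace_comp_comm']

theorem sqrt_tensorInner_killingOp_le (A : TangentSpace (𝓡 n) x →ₗ[ℝ] TangentSpace (𝓡 n) x) :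
    Real.sqrt (tensorInner (killingOp A) (killingOp A)) ≤ 2 * Real.sqrt (tensorInner A A) := by
  have h := norm_add_le (tensorVec A) (tensorVec (LinearMap.adjoint A))
  rw [← map_add, norm_tensorVec, norm_tensorVec, norm_tensorVec, tensorInner_adjoint] at h
  rw [killingOp]
  linarith

theorem tensorInner_conformalOp_le (A : TangentSpace (𝓡 n) x →ₗ[ℝ] TangentSpace (𝓡 n) x) :
    tensorInner (conformalOp A) (conformalOp A) ≤ tensorInner (killingOp A) (killingOp A) := by
  rw [tensorInner_conformalOp]
  have : 0 ≤ (4 / (n : ℝ)) * LinearMap.trace ℝ _ A ^ 2 := by positivity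
  linarith

theorem killingOp_sub (A B : TangentSpace (𝓡 n) x →ₗ[ℝ] TangentSpace (𝓡 n) x) :
    killingOp (A - B) = killingOp A - killingOp B := by
  simp only [killingOp, map_sub]; abel

theorem conformalOp_sub (A B : TangentSpace (𝓡 n) x →ₗ[ℝ] TangentSpace (𝓡 n) x) :
    conformalOp (A - B) = conformalOp A - conformalOp B := by
  simp only [conformalOp, killingOp_sub, map_sub, mul_sub, sub_smul]; abel

/-- The operator norm is bounded by the norm as a tensor. -/
theorem norm_le_sqrt_tensorInner (A : TangentSpace (𝓡 n) x →L[ℝ] TangentSpace (𝓡 n) x) :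
    ‖A‖ ≤ Real.sqrt (tensorInner (A : TangentSpace (𝓡 n) x →ₗ[ℝ] TangentSpace (𝓡 n) x) A) := by
  refine A.opNorm_le_bound (Real.sqrt_nonneg _) fun v => ?_
  set b := stdOrthonormalBasis ℝ (TangentSpace (𝓡 n) x)
  have h1 : ‖A v‖ ≤ ∑ i, |inner ℝ (b i) v| * ‖A (b i)‖ := by
    conv_lhs => rw [← b.sum_repr' v]
    rw [map_sum]
    refine (norm_sum_le _ _).trans (Finset.sum_le_sum fun i _ => ?_)
    rw [map_smul, norm_smul, Real.norm_eq_abs]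
  have h2 := Real.sum_mul_le_sqrt_mul_sqrt Finset.univ (fun i => |inner ℝ (b i) v|)
    (fun i => ‖A (b i)‖)
  have h3 : Real.sqrt (∑ i, |inner ℝ (b i) v| ^ 2) = ‖v‖ := by
    simp only [sq_abs]
    rw [b.sum_sq_inner_right, Real.sqrt_sq (norm_nonneg v)]
  rw [h3] at h2
  rw [tensorInner_eq_sum b, mul_comm]
  simp only [real_inner_self_eq_norm_sq]
  exact h1.trans h2

end TensorAlgebra

/-! ### Tensor norms in charts and boundedness of the Ricci tensor -/

section TensorCoordinates

variable {n : ℕ} {M : Type*} [TopologicalSpace M] [ChartedSpace (Model n) M]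
  [IsManifold (𝓡 n) ∞ M]

/-- The inner product of `(1,1)` tensors, in terms of the matrices of the metric and its inverse
and of the matrix of the tensor. -/
def tensorNormSqCoord (g ginv a : Matrix (Fin n) (Fin n) ℝ) : ℝ :=
  (a * ginv * a.transpose * g).trace

/-- With the inverse metric as an independent argument the expression is a polynomial. It can then
be composed with continuous matrices as well as with merely measurable ones. -/
theorem continuous_tensorNormSqCoord : Continuous
    fun q : (Fin n → Fin n → ℝ) × (Fin n → Fin n → ℝ) × (Fin n → Fin n → ℝ) =>
      tensorNormSqCoord (Matrix.of q.1) (Matrix.of q.2.1) (Matrix.of q.2.2) := by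
  simp only [tensorNormSqCoord, Matrix.trace, Matrix.diag, Matrix.mul_apply, Matrix.transpose_apply,
    Matrix.of_apply]
  fun_prop

/-- The matrix of a linear map in the chart at `p`. -/
def compMatrix (p : M) (x : M) (A : TangentSpace (𝓡 n) x →ₗ[ℝ] TangentSpace (𝓡 n) x) :
    Matrix (Fin n) (Fin n) ℝ :=
  Matrix.of fun i j => coordComp p i x (A (coordField p j x))

theorem compMatrix_eq_toMatrix (p : M) {x : M} (hp : x ∈ (chartAt (Model n) p).source)
    (A : TangentSpace (𝓡 n) x →ₗ[ℝ] TangentSpace (𝓡 n) x) :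
    compMatrix p x A = LinearMap.toMatrix (frame p hp) (frame p hp) A := by
  ext i j
  rw [LinearMap.toMatrix_apply, ← coordComp_eq, ← coordField_eq]
  rfl

theorem trace_eq_compMatrix (p : M) {x : M} (hp : x ∈ (chartAt (Model n) p).source)
    (A : TangentSpace (𝓡 n) x →ₗ[ℝ] TangentSpace (𝓡 n) x) :
    LinearMap.trace ℝ _ A = (compMatrix p x A).trace := by
  rw [compMatrix_eq_toMatrix p hp, LinearMap.trace_eq_matrix_trace ℝ (frame p hp)]

theorem compMatrix_comp (p : M) {x : M} (hp : x ∈ (chartAt (Model n) p).source)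
    (A B : TangentSpace (𝓡 n) x →ₗ[ℝ] TangentSpace (𝓡 n) x) :
    compMatrix p x (A ∘ₗ B) = compMatrix p x A * compMatrix p x B := by
  simp only [compMatrix_eq_toMatrix p hp]
  rw [LinearMap.toMatrix_comp _ (frame p hp)]

theorem continuousOn_fieldCoord {u : ∀ x : M, TangentSpace (𝓡 n) x}
    (hu : SmoothCoordOn u Set.univ) (p : M) (i : Fin n) :
    ContinuousOn (fieldCoord u p i) (extChartAt (𝓡 n) p).target := by
  simpa only [Set.preimage_univ, Set.inter_univ] using (hu p i).continuousOn

variable [RiemannianBundle (fun x : M => TangentSpace (𝓡 n) x)]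

theorem metricCoord_mul_compMatrix (p : M) {x : M} (hp : x ∈ (chartAt (Model n) p).source)
    (A : TangentSpace (𝓡 n) x →ₗ[ℝ] TangentSpace (𝓡 n) x) (i j : Fin n) :
    (metricCoord p (extChartAt (𝓡 n) p x) * compMatrix p x A) i j =
      inner ℝ (coordField p i x) (A (coordField p j x)) := by
  have h : A (coordField p j x) =
      ∑ k, coordComp p k x (A (coordField p j x)) • coordField p k x := by
    simp only [coordComp_eq p hp, coordField_eq p hp]
    exact ((frame p hp).sum_repr _).symm
  conv_rhs => rw [h, inner_sum]
  rw [Matrix.mul_apply]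
  refine Finset.sum_congr rfl fun k _ => ?_
  rw [real_inner_smul_right, metricCoord_extChartAt p hp, mul_comm]
  rfl

theorem isUnit_det_metricCoord (p : M) {x : M} (hp : x ∈ (chartAt (Model n) p).source) :
    IsUnit (metricCoord p (extChartAt (𝓡 n) p x)).det :=
  (metricCoord_det_pos p (extChartAt_mem hp)).ne'.isUnit

/-- Pairing with the frame turns the adjoint into a transpose, `g A* = Aᵀ g`, and `g` is invertible.
-/
theorem compMatrix_adjoint (p : M) {x : M} (hp : x ∈ (chartAt (Model n) p).source)
    (A : TangentSpace (𝓡 n) x →ₗ[ℝ] TangentSpace (𝓡 n) x) :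
    compMatrix p x (LinearMap.adjoint A) = (metricCoord p (extChartAt (𝓡 n) p x))⁻¹ *
      (compMatrix p x A).transpose * metricCoord p (extChartAt (𝓡 n) p x) := by
  have h : metricCoord p (extChartAt (𝓡 n) p x) * compMatrix p x (LinearMap.adjoint A) =
      (compMatrix p x A).transpose * metricCoord p (extChartAt (𝓡 n) p x) := by
    ext i j
    rw [metricCoord_mul_compMatrix p hp, LinearMap.adjoint_inner_right, real_inner_comm,
      ← metricCoord_mul_compMatrix p hp, ← Matrix.transpose_apply (_ * _) i j,
      Matrix.transpose_mul, (metricCoord_isSymm p _).eq]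
  rw [mul_assoc, ← h, ← mul_assoc, Matrix.nonsing_inv_mul _ (isUnit_det_metricCoord p hp), one_mul]

theorem tensorInner_self_eq (p : M) {x : M} (hp : x ∈ (chartAt (Model n) p).source)
    (A : TangentSpace (𝓡 n) x →ₗ[ℝ] TangentSpace (𝓡 n) x) :
    tensorInner A A = tensorNormSqCoord (metricCoord p (extChartAt (𝓡 n) p x))
      (metricCoord p (extChartAt (𝓡 n) p x))⁻¹ (compMatrix p x A) := by
  rw [tensorInner, trace_eq_compMatrix p hp, compMatrix_comp p hp, compMatrix_adjoint p hp,
    ← mul_assoc, ← mul_assoc]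
  rfl

variable [IsContMDiffRiemannianBundle (𝓡 n) ∞ (Model n) (fun x : M => TangentSpace (𝓡 n) x)]

theorem continuousOn_metricCoord_inv (p : M) (i j : Fin n) :
    ContinuousOn (fun y => (metricCoord p y)⁻¹ i j) (extChartAt (𝓡 n) p).target :=
  (contDiffOn_inv (A := metricCoord p) (contDiffOn_metricCoord p)
    (fun _ hz => (metricCoord_det_pos p hz).ne') i j).continuousOn

theorem continuousOn_tensorNormSqCoord (p : M) {a : Model n → Matrix (Fin n) (Fin n) ℝ}
    (ha : ∀ i j, ContinuousOn (fun y => a y i j) (extChartAt (𝓡 n) p).target) :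
    ContinuousOn (fun y => tensorNormSqCoord (metricCoord p y) (metricCoord p y)⁻¹ (a y))
      (extChartAt (𝓡 n) p).target :=
  continuous_tensorNormSqCoord.comp_continuousOn
    (f := fun y => ((fun i j => metricCoord p y i j), (fun i j => (metricCoord p y)⁻¹ i j),
      fun i j => a y i j))
    ((continuousOn_pi.2 fun i => continuousOn_pi.2 fun j =>
      (contDiffOn_metricCoord p i j).continuousOn).prodMk
    ((continuousOn_pi.2 fun i => continuousOn_pi.2 fun j =>
      continuousOn_metricCoord_inv p i j).prodMk
    (continuousOn_pi.2 fun i => continuousOn_pi.2 fun j => ha i j)))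

theorem compMatrix_ricci (p : M) {x : M} (hp : x ∈ (chartAt (Model n) p).source) :
    compMatrix p x (ricci x).toLinearMap = (metricCoord p (extChartAt (𝓡 n) p x))⁻¹ *
      ricciCoord p (extChartAt (𝓡 n) p x) := by
  have h : metricCoord p (extChartAt (𝓡 n) p x) * compMatrix p x (ricci x).toLinearMap =
      ricciCoord p (extChartAt (𝓡 n) p x) := by
    ext i j
    rw [metricCoord_mul_compMatrix p hp, real_inner_comm]
    refine (inner_ricci p hp _ _).trans ?_
    simp only [coordField_eq p hp, coordComp_eq p hp, Module.Basis.repr_self]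
    simp [Finsupp.single_apply]
  rw [← h, ← mul_assoc, Matrix.nonsing_inv_mul _ (isUnit_det_metricCoord p hp), one_mul]

theorem contDiffOn_ricciCoord (p : M) (j k : Fin n) :
    ContDiffOn ℝ ∞ (fun y => ricciCoord p y j k) (extChartAt (𝓡 n) p).target := by
  have hc := contDiffOn_christoffel (n := n) (M := M) p
  have ho := isOpen_extChartAt_target (I := 𝓡 n) p
  simp only [ricciCoord, Matrix.of_apply]
  exact ContDiffOn.sum fun i _ => ((contDiffOn_partialDeriv ho (hc i j k) i).sub
    (contDiffOn_partialDeriv ho (hc i i k) j)).add (ContDiffOn.sum fun l _ =>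
      ((hc i i l).mul (hc l j k)).sub ((hc i j l).mul (hc l i k)))

/-- The tensor norm replaces the operator norm here: it dominates it and has an explicit continuous
expression in each chart. -/
theorem continuous_tensorInner_ricci :
    Continuous fun x : M => tensorInner (ricci (n := n) x).toLinearMap
      (ricci (n := n) x).toLinearMap := by
  refine continuous_of_chart (n := n) (fun (p : M) (y : Model n) =>
    tensorNormSqCoord (metricCoord p y) (metricCoord p y)⁻¹
      ((metricCoord p y)⁻¹ * ricciCoord p y)) (fun p => ?_) fun p x hx => ?_
  · refine continuousOn_tensorNormSqCoord p fun i j => ?_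
    simp only [Matrix.mul_apply]
    exact continuousOn_finsetSum _ fun k _ =>
      (continuousOn_metricCoord_inv p i k).mul (contDiffOn_ricciCoord p k j).continuousOn
  · rw [tensorInner_self_eq p hx, compMatrix_ricci p hx]

/-- The Ricci tensor of a compact manifold is bounded. -/
theorem bddAbove_norm_ricci [CompactSpace M] :
    BddAbove (Set.range fun x : M => ‖ricci (n := n) x‖) := by
  obtain ⟨C, hC⟩ := (isCompact_range (continuous_tensorInner_ricci (n := n) (M := M))).bddAbove
  refine ⟨Real.sqrt C, ?_⟩
  rintro _ ⟨x, rfl⟩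
  exact (norm_le_sqrt_tensorInner _).trans (Real.sqrt_le_sqrt (hC ⟨x, rfl⟩))

/-! ### Continuity of the quadratic expressions in a smooth field -/

variable {u : ∀ x : M, TangentSpace (𝓡 n) x}

theorem continuousOn_covDerivCoord (hu : SmoothCoordOn u Set.univ) (p : M) (i j : Fin n) :
    ContinuousOn (fun y => covDerivCoord u p y i j) (extChartAt (𝓡 n) p).target := by
  simpa only [Set.preimage_univ, Set.inter_univ] using
    (contDiffOn_covDerivCoord isOpen_univ hu p i j).continuousOn

theorem compMatrix_covDeriv (hu : SmoothCoordOn u Set.univ) (p : M) {x : M}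
    (hp : x ∈ (chartAt (Model n) p).source) :
    compMatrix p x (covDeriv u x) = covDerivCoord u p (extChartAt (𝓡 n) p x) := by
  rw [compMatrix_eq_toMatrix p hp, toMatrix_covDeriv isOpen_univ hu p (Set.mem_univ x) hp]

theorem continuous_inner_self (hu : SmoothCoordOn u Set.univ) :
    Continuous fun x => inner ℝ (u x) (u x) := by
  refine continuous_of_chart (fun (p : M) y => bil (metricCoord p y) (fun i => fieldCoord u p i y)
    (fun i => fieldCoord u p i y)) (fun p => ?_) fun p x hx => ?_
  · exact continuousOn_finsetSum _ fun i _ => continuousOn_finsetSum _ fun j _ =>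
      (contDiffOn_metricCoord p i j).continuousOn.mul
        ((continuousOn_fieldCoord hu p i).mul (continuousOn_fieldCoord hu p j))
  · simp only [inner_eq_bil p hx, fieldCoord_extChartAt _ p hx]

theorem continuous_inner_ricci (hu : SmoothCoordOn u Set.univ) :
    Continuous fun x => inner ℝ (ricci x (u x)) (u x) := by
  refine continuous_of_chart (fun (p : M) y => ∑ j, ∑ k, ricciCoord p y j k *
    (fieldCoord u p j y * fieldCoord u p k y)) (fun p => ?_) fun p x hx => ?_
  · exact continuousOn_finsetSum _ fun i _ => continuousOn_finsetSum _ fun j _ =>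
      (contDiffOn_ricciCoord p i j).continuousOn.mul
        ((continuousOn_fieldCoord hu p i).mul (continuousOn_fieldCoord hu p j))
  · simp only [inner_ricci p hx, fieldCoord_extChartAt _ p hx]

theorem continuous_tensorInner_covDeriv (hu : SmoothCoordOn u Set.univ) :
    Continuous fun x => tensorInner (covDeriv u x) (covDeriv u x) := by
  refine continuous_of_chart (fun (p : M) y => tensorNormSqCoord (metricCoord p y) (metricCoord p y)⁻¹
    (covDerivCoord u p y)) (fun p => ?_) fun p x hx => ?_
  · exact continuousOn_tensorNormSqCoord p (continuousOn_covDerivCoord hu p)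
  · rw [tensorInner_self_eq p hx, compMatrix_covDeriv hu p hx]

theorem continuous_trace_covDeriv_comp (hu : SmoothCoordOn u Set.univ) :
    Continuous fun x => LinearMap.trace ℝ _ (covDeriv u x ∘ₗ covDeriv u x) := by
  refine continuous_of_chart (fun (p : M) y => (covDerivCoord u p y * covDerivCoord u p y).trace)
    (fun p => ?_) fun p x hx =>
      trace_covDeriv_comp isOpen_univ hu hu p (Set.mem_univ x) hx
  have h := continuousOn_covDerivCoord hu p
  simp only [Matrix.trace, Matrix.diag, Matrix.mul_apply]
  exact continuousOn_finsetSum _ fun i _ => continuousOn_finsetSum _ fun j _ =>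
    (h i j).mul (h j i)

theorem continuous_tensorInner_killingOp (hu : SmoothCoordOn u Set.univ) :
    Continuous fun x => tensorInner (killingOp (covDeriv u x)) (killingOp (covDeriv u x)) := by
  simp only [tensorInner_killingOp]
  exact ((continuous_tensorInner_covDeriv hu).const_mul 2).add
    ((continuous_trace_covDeriv_comp hu).const_mul 2)

theorem continuous_tensorInner_conformalOp (hu : SmoothCoordOn u Set.univ) :
    Continuous fun x => tensorInner (conformalOp (covDeriv u x)) (conformalOp (covDeriv u x)) := by
  simp only [tensorInner_conformalOp]
  exact (continuous_tensorInner_killingOp hu).sub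
    (((continuous_trace_covDeriv hu).pow 2).const_mul _)

theorem half_tensorInner_killingOp (hu : SmoothCoordOn u Set.univ) (x : M) :
    1 / 2 * tensorInner (killingOp (covDeriv u x)) (killingOp (covDeriv u x)) =
      tensorInner (covDeriv u x) (covDeriv u x) + LinearMap.trace ℝ _ (covDeriv u x) ^ 2 -
        inner ℝ (ricci x (u x)) (u x) +
        LinearMap.trace ℝ _ (covDeriv (yanoField u u) x) := by
  rw [tensorInner_killingOp, trace_covDeriv_yanoField hu]
  ring

/-- Removing the trace costs half of `(4/n) div(u)²`, which lowers the coefficient of `div(u)²` from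
`1` to `1 - 2/n`. -/
theorem half_tensorInner_conformalOp (hu : SmoothCoordOn u Set.univ) (x : M) :
    1 / 2 * tensorInner (conformalOp (covDeriv u x)) (conformalOp (covDeriv u x)) =
      tensorInner (covDeriv u x) (covDeriv u x) +
        (1 - 2 / n) * LinearMap.trace ℝ _ (covDeriv u x) ^ 2 -
        inner ℝ (ricci x (u x)) (u x) +
        LinearMap.trace ℝ _ (covDeriv (yanoField u u) x) := by
  have := half_tensorInner_killingOp hu x
  rw [tensorInner_conformalOp, mul_sub, this]
  ring

end TensorCoordinates

/-! ### Passing from smooth fields to `H¹` -/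

theorem norm_toLp_sq {α : Type*} [MeasurableSpace α] {μ : Measure α} {f : α → ℝ}
    (hf : MemLp f 2 μ) : ‖hf.toLp f‖ ^ 2 = ∫ x, f x ^ 2 ∂μ := by
  rw [← real_inner_self_eq_norm_sq, L2.inner_def]
  refine integral_congr_ae ?_
  filter_upwards [hf.coeFn_toLp] with x hx
  rw [hx, real_inner_self_eq_norm_sq, Real.norm_eq_abs, sq_abs]

theorem tendsto_integral_sq {α : Type*} [MeasurableSpace α] {μ : Measure α} {f : ℕ → α → ℝ}
    {g : α → ℝ} (hf : ∀ k, MemLp (f k) 2 μ) (hg : AEStronglyMeasurable g μ)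
    (h : Tendsto (fun k => eLpNorm (f k - g) 2 μ) atTop (𝓝 0)) :
    MemLp g 2 μ ∧ Tendsto (fun k => ∫ x, f k x ^ 2 ∂μ) atTop (𝓝 (∫ x, g x ^ 2 ∂μ)) := by
  have hg2 : MemLp g 2 μ := by
    obtain ⟨k, hk⟩ := (h.eventually (gt_mem_nhds ENNReal.zero_lt_top)).exists
    have h1 : MemLp (f k - g) 2 μ := ⟨(hf k).1.sub hg, hk⟩
    simpa using (hf k).sub h1
  refine ⟨hg2, ?_⟩
  have := ((Lp.tendsto_Lp_iff_tendsto_eLpNorm'' f hf g hg2).2 h).norm.pow 2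
  simpa only [norm_toLp_sq] using this

section Approximation

variable {n : ℕ} {M : Type*} [TopologicalSpace M] [CompactSpace M] [ChartedSpace (Model n) M]
  [IsManifold (𝓡 n) ∞ M] [RiemannianBundle (fun x : M => TangentSpace (𝓡 n) x)]
  [IsContMDiffRiemannianBundle (𝓡 n) ∞ (Model n) (fun x : M => TangentSpace (𝓡 n) x)]
  [MeasurableSpace M] [BorelSpace M]

theorem integrable_of_continuous {f : M → ℝ} (hf : Continuous f) :
    Integrable f (riemannianMeasure n M) :=
  hf.integrable_of_hasCompactSupport (HasCompactSupport.of_compactSpace _)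

/-- Each quadratic expression is the square of a pointwise norm. The pointwise bound makes these
norms converge in `L²`, hence their squares converge in integral; `c` allows for the norm of a
linear operator applied to `∇u`. -/
theorem tendsto_integral_of_sqrt {F d : ℕ → M → ℝ} {G : M → ℝ} (hFc : ∀ k, Continuous (F k))
    (hF : ∀ k x, 0 ≤ F k x) (hG : ∀ x, 0 ≤ G x) (hGm : AEMeasurable G (riemannianMeasure n M))
    (c : ℝ) (hd : ∀ k x, |Real.sqrt (F k x) - Real.sqrt (G x)| ≤ c * d k x)
    (hlim : Tendsto (fun k => eLpNorm (d k) 2 (riemannianMeasure n M)) atTop (𝓝 0)) :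
    Integrable G (riemannianMeasure n M) ∧
      Tendsto (fun k => ∫ x, F k x ∂(riemannianMeasure n M)) atTop
        (𝓝 (∫ x, G x ∂(riemannianMeasure n M))) := by
  have h1 : ∀ k, MemLp (fun x => Real.sqrt (F k x)) 2 (riemannianMeasure n M) := fun k =>
    (hFc k).sqrt.memLp_of_hasCompactSupport (HasCompactSupport.of_compactSpace _)
  have h2 : Tendsto (fun k => eLpNorm ((fun x => Real.sqrt (F k x)) - fun x => Real.sqrt (G x)) 2
      (riemannianMeasure n M)) atTop (𝓝 0) := by
    have h3 : Tendsto (fun k => ‖c‖ₑ * eLpNorm (d k) 2 (riemannianMeasure n M)) atTop (𝓝 0) := by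
      simpa using ENNReal.Tendsto.const_mul hlim (Or.inr (enorm_ne_top (x := c)))
    refine tendsto_of_tendsto_of_tendsto_of_le_of_le tendsto_const_nhds h3
      (fun k => zero_le) fun k => ?_
    simp only
    rw [← eLpNorm_const_smul]
    exact eLpNorm_mono_real fun x => hd k x
  have h4 := tendsto_integral_sq h1 hGm.sqrt.aestronglyMeasurable h2
  simp only [Real.sq_sqrt (hF _ _), Real.sq_sqrt (hG _)] at h4
  refine ⟨?_, h4.2⟩
  simpa only [Real.sq_sqrt (hG _)] using h4.1.integrable_sq

-- Almost everywhere measurability glues over countable covers, and compactness supplies a finite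
-- one by charts.
omit [IsManifold (𝓡 n) ∞ M] [RiemannianBundle (fun x : M => TangentSpace (𝓡 n) x)]
  [IsContMDiffRiemannianBundle (𝓡 n) ∞ (Model n) (fun x : M => TangentSpace (𝓡 n) x)]
  [BorelSpace M] in
theorem aemeasurable_of_chart {f : M → ℝ} {μ : Measure M} (F : M → M → ℝ)
    (hF : ∀ p, AEMeasurable (F p) (μ.restrict (chartAt (Model n) p).source))
    (h : ∀ p, ∀ x ∈ (chartAt (Model n) p).source, f x = F p x)
    [OpensMeasurableSpace M] : AEMeasurable f μ := by
  obtain ⟨t, ht⟩ := CompactSpace.elim_nhds_subcover (fun x : M => (chartAt (Model n) x).source)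
    fun x => (chartAt (Model n) x).open_source.mem_nhds (mem_chart_source _ x)
  have hU : (Set.univ : Set M) = ⋃ x : t, (chartAt (Model n) (x : M)).source := by
    rw [← Set.top_eq_univ, ← ht]
    exact Set.biUnion_eq_iUnion (t : Set M) fun x _ => (chartAt (Model n) x).source
  rw [← Measure.restrict_univ (μ := μ), hU, aemeasurable_iUnion_iff]
  rintro ⟨p, _⟩
  refine (hF p).congr ?_
  filter_upwards [ae_restrict_mem (chartAt (Model n) p).open_source.measurableSet] with x hx
  exact (h p x hx).symm

omit [CompactSpace M] [IsManifold (𝓡 n) ∞ M]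
  [RiemannianBundle (fun x : M => TangentSpace (𝓡 n) x)]
  [IsContMDiffRiemannianBundle (𝓡 n) ∞ (Model n) (fun x : M => TangentSpace (𝓡 n) x)] in
theorem aemeasurable_comp_extChartAt {μ : Measure M} (p : M) {F : Model n → ℝ}
    (hF : ContinuousOn F (extChartAt (𝓡 n) p).target) :
    AEMeasurable (fun x => F (extChartAt (𝓡 n) p x))
      (μ.restrict (chartAt (Model n) p).source) := by
  have h := continuousOn_extChartAt (I := 𝓡 n) p
  rw [extChartAt_source] at h
  exact (hF.comp h fun x hx => extChartAt_mem hx).aemeasurable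
    (chartAt (Model n) p).open_source.measurableSet

variable (u : H1Field n M)

theorem H1Field.aemeasurable_inner_self :
    AEMeasurable (fun x => inner ℝ (u.field x) (u.field x)) (riemannianMeasure n M) := by
  refine aemeasurable_of_chart (n := n) (fun p x => bil (metricCoord p (extChartAt (𝓡 n) p x))
    (fun i => coordComp p i x (u.field x)) fun i => coordComp p i x (u.field x))
    (fun p => ?_) fun p x hx => inner_eq_bil p hx _ _
  simp only [bil]
  refine Finset.aemeasurable_fun_sum _ fun i _ => Finset.aemeasurable_fun_sum _ fun j _ => ?_
  exact (aemeasurable_comp_extChartAt p (contDiffOn_metricCoord p i j).continuousOn).mul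
    ((u.aemeasurable_field p i).restrict.mul (u.aemeasurable_field p j).restrict)

theorem H1Field.aemeasurable_tensorInner :
    AEMeasurable (fun x => tensorInner (u.cov x) (u.cov x)) (riemannianMeasure n M) := by
  refine aemeasurable_of_chart (n := n) (fun p x =>
    tensorNormSqCoord (metricCoord p (extChartAt (𝓡 n) p x))
      (metricCoord p (extChartAt (𝓡 n) p x))⁻¹ (compMatrix p x (u.cov x)))
    (fun p => ?_) fun p x hx => tensorInner_self_eq p hx _
  refine continuous_tensorNormSqCoord.measurable.comp_aemeasurable
    (f := fun x => ((fun i j => metricCoord p (extChartAt (𝓡 n) p x) i j),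
      (fun i j => (metricCoord p (extChartAt (𝓡 n) p x))⁻¹ i j),
      fun i j => compMatrix p x (u.cov x) i j))
    (AEMeasurable.prodMk ?_ (AEMeasurable.prodMk ?_ ?_)) <;>
  refine aemeasurable_pi_iff.2 fun i => aemeasurable_pi_iff.2 fun j => ?_
  · exact aemeasurable_comp_extChartAt p (contDiffOn_metricCoord p i j).continuousOn
  · exact aemeasurable_comp_extChartAt p (continuousOn_metricCoord_inv p i j)
  · exact (u.aemeasurable_cov p i j).restrict

omit [IsContMDiffRiemannianBundle (𝓡 n) ∞ (Model n) fun x : M => TangentSpace (𝓡 n) x] in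
theorem H1Field.aemeasurable_trace :
    AEMeasurable (fun x => LinearMap.trace ℝ _ (u.cov x)) (riemannianMeasure n M) := by
  refine aemeasurable_of_chart (n := n) (fun p x => (compMatrix p x (u.cov x)).trace)
    (fun p => ?_) fun p x hx => trace_eq_compMatrix p hx _
  simp only [Matrix.trace, Matrix.diag]
  exact Finset.aemeasurable_fun_sum _ fun i _ => (u.aemeasurable_cov p i i).restrict

omit [IsContMDiffRiemannianBundle (𝓡 n) ∞ (Model n) fun x : M => TangentSpace (𝓡 n) x] in
theorem H1Field.aemeasurable_trace_comp :
    AEMeasurable (fun x => LinearMap.trace ℝ _ (u.cov x ∘ₗ u.cov x)) (riemannianMeasure n M) := by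
  refine aemeasurable_of_chart (n := n)
    (fun p x => (compMatrix p x (u.cov x) * compMatrix p x (u.cov x)).trace)
    (fun p => ?_) fun p x hx => by rw [trace_eq_compMatrix p hx, compMatrix_comp p hx]
  simp only [Matrix.trace, Matrix.diag, Matrix.mul_apply]
  exact Finset.aemeasurable_fun_sum _ fun i _ => Finset.aemeasurable_fun_sum _ fun j _ =>
    (u.aemeasurable_cov p i j).restrict.mul (u.aemeasurable_cov p j i).restrict

theorem H1Field.aemeasurable_killingOp :
    AEMeasurable (fun x => tensorInner (killingOp (u.cov x)) (killingOp (u.cov x)))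
      (riemannianMeasure n M) := by
  simp only [tensorInner_killingOp]
  exact (u.aemeasurable_tensorInner.const_mul 2).add (u.aemeasurable_trace_comp.const_mul 2)

theorem H1Field.aemeasurable_conformalOp :
    AEMeasurable (fun x => tensorInner (conformalOp (u.cov x)) (conformalOp (u.cov x)))
      (riemannianMeasure n M) := by
  simp only [tensorInner_conformalOp]
  exact u.aemeasurable_killingOp.sub ((u.aemeasurable_trace.pow_const 2).const_mul _)

/-- The integrals of all quadratic expressions in an `H¹` field are limits of the integrals for
smooth fields. -/
theorem H1Field.exists_approx : ∃ φ : ℕ → ∀ x : M, TangentSpace (𝓡 n) x,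
    (∀ k, SmoothCoordOn (φ k) Set.univ) ∧
    (Integrable (fun x => inner ℝ (u.field x) (u.field x)) (riemannianMeasure n M) ∧
      Tendsto (fun k => ∫ x, inner ℝ (φ k x) (φ k x) ∂(riemannianMeasure n M)) atTop
        (𝓝 (∫ x, inner ℝ (u.field x) (u.field x) ∂(riemannianMeasure n M)))) ∧
    (Integrable (fun x => tensorInner (u.cov x) (u.cov x)) (riemannianMeasure n M) ∧
      Tendsto (fun k => ∫ x, tensorInner (covDeriv (φ k) x) (covDeriv (φ k) x)
        ∂(riemannianMeasure n M)) atTop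
        (𝓝 (∫ x, tensorInner (u.cov x) (u.cov x) ∂(riemannianMeasure n M)))) ∧
    (Integrable (fun x => tensorInner (killingOp (u.cov x)) (killingOp (u.cov x)))
        (riemannianMeasure n M) ∧
      Tendsto (fun k => ∫ x, tensorInner (killingOp (covDeriv (φ k) x))
        (killingOp (covDeriv (φ k) x)) ∂(riemannianMeasure n M)) atTop
        (𝓝 (∫ x, tensorInner (killingOp (u.cov x)) (killingOp (u.cov x))
          ∂(riemannianMeasure n M)))) ∧
    (Integrable (fun x => tensorInner (conformalOp (u.cov x)) (conformalOp (u.cov x)))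
        (riemannianMeasure n M) ∧
      Tendsto (fun k => ∫ x, tensorInner (conformalOp (covDeriv (φ k) x))
        (conformalOp (covDeriv (φ k) x)) ∂(riemannianMeasure n M)) atTop
        (𝓝 (∫ x, tensorInner (conformalOp (u.cov x)) (conformalOp (u.cov x))
          ∂(riemannianMeasure n M)))) := by
  obtain ⟨φ, hφ, h0, h1⟩ := u.approx
  have hs := fun k => (hφ k).smoothCoordOn
  refine ⟨φ, hs, ?_, ?_, ?_, ?_⟩
  · refine tendsto_integral_of_sqrt (fun k => continuous_inner_self (hs k))
      (fun k x => real_inner_self_nonneg) (fun x => real_inner_self_nonneg)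
      u.aemeasurable_inner_self 1 (fun k x => ?_) h0
    rw [← norm_eq_sqrt_real_inner, ← norm_eq_sqrt_real_inner, one_mul]
    exact abs_norm_sub_norm_le _ _
  · refine tendsto_integral_of_sqrt (fun k => continuous_tensorInner_covDeriv (hs k))
      (fun k x => tensorInner_self_nonneg _) (fun x => tensorInner_self_nonneg _)
      u.aemeasurable_tensorInner 1 (fun k x => ?_) h1
    rw [one_mul]
    exact abs_sqrt_tensorInner_sub_le _ _
  -- The constant `2` comes from `|A + A*| ≤ 2|A|`. It also serves the conformal operator, whose
  -- norm is at most that of the Killing operator.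
  · refine tendsto_integral_of_sqrt (fun k => continuous_tensorInner_killingOp (hs k))
      (fun k x => tensorInner_self_nonneg _) (fun x => tensorInner_self_nonneg _)
      u.aemeasurable_killingOp 2 (fun k x => ?_) h1
    refine (abs_sqrt_tensorInner_sub_le _ _).trans ?_
    rw [← killingOp_sub]
    exact sqrt_tensorInner_killingOp_le _
  · refine tendsto_integral_of_sqrt (fun k => continuous_tensorInner_conformalOp (hs k))
      (fun k x => tensorInner_self_nonneg _) (fun x => tensorInner_self_nonneg _)
      u.aemeasurable_conformalOp 2 (fun k x => ?_) h1
    refine (abs_sqrt_tensorInner_sub_le _ _).trans ?_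
    rw [← conformalOp_sub]
    exact (Real.sqrt_le_sqrt (tensorInner_conformalOp_le _)).trans
      (sqrt_tensorInner_killingOp_le _)

end Approximation

/-! ### Korn inequalities, coercivity and vanishing theorems -/

section Korn

variable {n : ℕ} {M : Type*} [TopologicalSpace M] [ChartedSpace (Model n) M]
  [IsManifold (𝓡 n) ∞ M] [RiemannianBundle (fun x : M => TangentSpace (𝓡 n) x)]
  {u : ∀ x : M, TangentSpace (𝓡 n) x}

/-- This sign is where dimension at least two enters the conformal case. -/
theorem one_sub_two_div_nonneg (hn : 2 ≤ n) : (0 : ℝ) ≤ 1 - 2 / n := by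
  have h : (2 : ℝ) ≤ n := by exact_mod_cast hn
  rw [sub_nonneg, div_le_one (by linarith)]
  exact h

omit [IsManifold (𝓡 n) ∞ M] in
theorem inner_apply_self_le {x : M} (A : TangentSpace (𝓡 n) x →L[ℝ] TangentSpace (𝓡 n) x) {μ : ℝ}
    (hμ : ‖A‖ ≤ μ) (v : TangentSpace (𝓡 n) x) : inner ℝ (A v) v ≤ μ * inner ℝ v v := by
  rw [real_inner_self_eq_norm_mul_norm, ← mul_assoc]
  exact (real_inner_le_norm _ _).trans
    (mul_le_mul_of_nonneg_right (A.le_of_opNorm_le hμ v) (norm_nonneg _))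

variable [T2Space M] [CompactSpace M]
  [IsContMDiffRiemannianBundle (𝓡 n) ∞ (Model n) (fun x : M => TangentSpace (𝓡 n) x)]
  [MeasurableSpace M] [BorelSpace M]

/-- Bochner's integrated inequality for a function, half of which agrees with
`|∇u|² + c div(u)² - Ri(u, u)`, where `c ≥ 0`, up to a divergence. -/
theorem korn_of_bochner (hu : SmoothCoordOn u Set.univ) {F : M → ℝ} (hF : Continuous F) {c : ℝ}
    (hc : 0 ≤ c)
    (h : ∀ x, 1 / 2 * F x = tensorInner (covDeriv u x) (covDeriv u x) +
      c * LinearMap.trace ℝ _ (covDeriv u x) ^ 2 - inner ℝ (ricci x (u x)) (u x) +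
      LinearMap.trace ℝ _ (covDeriv (yanoField u u) x))
    {μ α : ℝ} (hμ : ∀ x : M, ‖ricci (n := n) x‖ ≤ μ) (hα : α ≤ 1) :
    α * (∫ x, inner ℝ (u x) (u x) ∂(riemannianMeasure n M) +
        ∫ x, tensorInner (covDeriv u x) (covDeriv u x) ∂(riemannianMeasure n M)) -
      (μ + α) * ∫ x, inner ℝ (u x) (u x) ∂(riemannianMeasure n M) ≤
      1 / 2 * ∫ x, F x ∂(riemannianMeasure n M) := by
  have hy := hu.yanoField isOpen_univ hu
  have i1 := integrable_of_continuous (n := n) (continuous_inner_self hu)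
  have i2 := integrable_of_continuous (n := n) (continuous_tensorInner_covDeriv hu)
  have i3 := integrable_of_continuous (n := n) (continuous_trace_covDeriv hy)
  have i4 := (integrable_of_continuous (n := n) hF).const_mul (1 / 2)
  have i5 : Integrable (fun x => α * tensorInner (covDeriv u x) (covDeriv u x) -
      μ * inner ℝ (u x) (u x)) (riemannianMeasure n M) := (i2.const_mul α).sub (i1.const_mul μ)
  -- The two terms `α ∫|u|²` cancel, and the added divergence has integral zero. It is inserted so
  -- that the integrands can be compared pointwise.
  calc _ = ∫ x, (α * tensorInner (covDeriv u x) (covDeriv u x) - μ * inner ℝ (u x) (u x) +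
        LinearMap.trace ℝ _ (covDeriv (yanoField u u) x)) ∂(riemannianMeasure n M) := by
        rw [integral_add i5 i3,
          integral_sub (i2.const_mul α) (i1.const_mul μ), integral_const_mul, integral_const_mul,
          integral_trace_covDeriv hy]
        ring
    _ ≤ _ := by
        rw [← integral_const_mul]
        refine integral_mono (i5.add i3) i4 fun x => ?_
        have h1 := inner_apply_self_le (ricci x) (hμ x) (u x)
        have h2 := mul_nonneg hc (sq_nonneg (LinearMap.trace ℝ _ (covDeriv u x)))
        have h3 := mul_le_mul_of_nonneg_right hα (tensorInner_self_nonneg (covDeriv u x))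
        simp only [h]
        linarith

/-- Bochner's vanishing argument. -/
theorem eq_zero_of_bochner (hR : RicciNegDef n M) (hu : SmoothCoordOn u Set.univ) {c : ℝ}
    (hc : 0 ≤ c)
    (h : ∀ x, 0 = tensorInner (covDeriv u x) (covDeriv u x) +
      c * LinearMap.trace ℝ _ (covDeriv u x) ^ 2 - inner ℝ (ricci x (u x)) (u x) +
      LinearMap.trace ℝ _ (covDeriv (yanoField u u) x)) : u = 0 := by
  have hy := hu.yanoField isOpen_univ hu
  have hcont : Continuous fun x => -inner ℝ (ricci x (u x)) (u x) := (continuous_inner_ricci hu).neg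
  have hnn : ∀ x, 0 ≤ -inner ℝ (ricci x (u x)) (u x) := fun x => by
    rcases eq_or_ne (u x) 0 with hx | hx
    · rw [hx, inner_zero_right, neg_zero]
    · exact neg_nonneg.2 (hR x (u x) hx).le
  -- The nonnegative terms `|∇u|²` and `c div(u)²` are dropped, leaving an integrated divergence as
  -- upper bound.
  have hle : ∫ x, -inner ℝ (ricci x (u x)) (u x) ∂(riemannianMeasure n M) ≤ 0 := by
    calc _ ≤ ∫ x, -LinearMap.trace ℝ _ (covDeriv (yanoField u u) x) ∂(riemannianMeasure n M) := by
          refine integral_mono (integrable_of_continuous hcont)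
            (integrable_of_continuous (continuous_trace_covDeriv hy)).neg fun x => ?_
          have h1 := h x
          have h2 := mul_nonneg hc (sq_nonneg (LinearMap.trace ℝ _ (covDeriv u x)))
          have h3 := tensorInner_self_nonneg (covDeriv u x)
          simp only
          linarith
      _ = 0 := by rw [integral_neg, integral_trace_covDeriv hy, neg_zero]
  funext x
  by_contra hx
  -- A nonzero value of `u` would make this continuous nonnegative integrand positive somewhere, and
  -- hence its integral positive.
  exact hle.not_gt (hcont.integral_pos_of_hasCompactSupport_nonneg_nonzero
    (HasCompactSupport.of_compactSpace _) hnn (x := x) (neg_pos.2 (hR x (u x) hx)).ne')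

theorem IsKilling.eq_zero (hR : RicciNegDef n M) (hu : IsKilling u) : u = 0 := by
  have hs := hu.1.smoothCoordOn
  refine eq_zero_of_bochner hR hs zero_le_one fun x => ?_
  rw [one_mul, ← half_tensorInner_killingOp hs, hu.2 x]
  simp [tensorInner]

theorem IsConformalKilling.eq_zero (hn : 2 ≤ n) (hR : RicciNegDef n M)
    (hu : IsConformalKilling u) : u = 0 := by
  have hs := hu.1.smoothCoordOn
  refine eq_zero_of_bochner hR hs (one_sub_two_div_nonneg hn) fun x => ?_
  rw [← half_tensorInner_conformalOp hs, hu.2 x]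
  simp [tensorInner]

section Sobolev

variable (u : H1Field n M)

omit [T2Space M] in
theorem formC_self_le_formK_self : formC u u ≤ formK u u := by
  obtain ⟨φ, -, -, -, ⟨hK, -⟩, hC, -⟩ := u.exists_approx
  exact mul_le_mul_of_nonneg_left (integral_mono hC hK fun x => tensorInner_conformalOp_le _)
    (by norm_num)

omit [T2Space M] [CompactSpace M]
  [IsContMDiffRiemannianBundle (𝓡 n) ∞ (Model n) (fun x : M => TangentSpace (𝓡 n) x)]
  [BorelSpace M] in
theorem normL2_sq : normL2 u ^ 2 =
    ∫ x, inner ℝ (u.field x) (u.field x) ∂(riemannianMeasure n M) :=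
  Real.sq_sqrt (integral_nonneg fun _ => real_inner_self_nonneg)

omit [T2Space M] in
theorem normH1_sq : normH1 u ^ 2 =
    ∫ x, inner ℝ (u.field x) (u.field x) ∂(riemannianMeasure n M) +
      ∫ x, tensorInner (u.cov x) (u.cov x) ∂(riemannianMeasure n M) := by
  obtain ⟨φ, -, ⟨h0, -⟩, ⟨h1, -⟩, -⟩ := u.exists_approx
  rw [← integral_add h0 h1]
  exact Real.sq_sqrt (integral_nonneg fun _ =>
    add_nonneg real_inner_self_nonneg (tensorInner_self_nonneg _))

variable {μ α : ℝ}

theorem le_formK (hμ : ∀ x : M, ‖ricci (n := n) x‖ ≤ μ) (hα : α ≤ 1) :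
    α * normH1 u ^ 2 - (μ + α) * normL2 u ^ 2 ≤ formK u u := by
  obtain ⟨φ, hφ, ⟨-, h0⟩, ⟨-, h1⟩, ⟨-, hK⟩, -⟩ := u.exists_approx
  rw [normH1_sq, normL2_sq, formK]
  refine le_of_tendsto_of_tendsto' (((h0.add h1).const_mul α).sub (h0.const_mul (μ + α)))
    (hK.const_mul (1 / 2)) fun k => ?_
  exact korn_of_bochner (hφ k) (continuous_tensorInner_killingOp (hφ k)) zero_le_one
    (fun x => by rw [one_mul, half_tensorInner_killingOp (hφ k)]) hμ hα

theorem le_formC (hn : 2 ≤ n) (hμ : ∀ x : M, ‖ricci (n := n) x‖ ≤ μ) (hα : α ≤ 1) :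
    α * normH1 u ^ 2 - (μ + α) * normL2 u ^ 2 ≤ formC u u := by
  obtain ⟨φ, hφ, ⟨-, h0⟩, ⟨-, h1⟩, -, -, hC⟩ := u.exists_approx
  rw [normH1_sq, normL2_sq, formC]
  refine le_of_tendsto_of_tendsto' (((h0.add h1).const_mul α).sub (h0.const_mul (μ + α)))
    (hC.const_mul (1 / 2)) fun k => ?_
  exact korn_of_bochner (hφ k) (continuous_tensorInner_conformalOp (hφ k))
    (one_sub_two_div_nonneg hn) (fun x => half_tensorInner_conformalOp (hφ k) x) hμ hα

end Sobolev

omit [T2Space M] [MeasurableSpace M] [BorelSpace M] in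
theorem exists_norm_ricci_le : ∃ μ : ℝ, ∀ x : M, ‖ricci (n := n) x‖ ≤ μ :=
  (bddAbove_norm_ricci (n := n) (M := M)).imp fun _ h x => h ⟨x, rfl⟩

theorem isCoerciveForm_formK : IsCoerciveForm (formK (n := n) (M := M)) := by
  obtain ⟨μ, hμ⟩ := exists_norm_ricci_le (n := n) (M := M)
  -- The choice `α = 1` in the Korn inequality gives the shift `μ + α = μ + 1`.
  exact ⟨1, one_pos, μ + 1, fun u => sub_le_iff_le_add.1 (le_formK u hμ le_rfl)⟩

theorem isCoerciveForm_formC (hn : 2 ≤ n) : IsCoerciveForm (formC (n := n) (M := M)) := by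
  obtain ⟨μ, hμ⟩ := exists_norm_ricci_le (n := n) (M := M)
  exact ⟨1, one_pos, μ + 1, fun u => sub_le_iff_le_add.1 (le_formC u hn hμ le_rfl)⟩

end Korn

end RiemannianKorn

end

theorem theorem2 (n : ℕ) (M : Type*) [TopologicalSpace M] [T2Space M] [CompactSpace M]
    [ChartedSpace (EuclideanSpace ℝ (Fin n)) M] [IsManifold (𝓡 n) ∞ M]
    [RiemannianBundle (fun x : M => TangentSpace (𝓡 n) x)]
    [IsContMDiffRiemannianBundle (𝓡 n) ∞ (EuclideanSpace ℝ (Fin n))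
      (fun x : M => TangentSpace (𝓡 n) x)]
    [MeasurableSpace M] [BorelSpace M] :
    -- the forms are coercive
    RiemannianKorn.IsCoerciveForm (RiemannianKorn.formK (n := n) (M := M)) ∧
    (2 ≤ n → RiemannianKorn.IsCoerciveForm (RiemannianKorn.formC (n := n) (M := M))) ∧
    -- the Ricci tensor is bounded, and any bound gives explicit constants
    BddAbove (Set.range fun x : M => ‖RiemannianKorn.ricci (n := n) x‖) ∧
    (∀ u : RiemannianKorn.H1Field n M,
      RiemannianKorn.formC u u ≤ RiemannianKorn.formK u u) ∧
    (∀ μ : ℝ, (∀ x : M, ‖RiemannianKorn.ricci (n := n) x‖ ≤ μ) →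
      ∀ α : ℝ, 0 < α → α ≤ 1 → ∀ u : RiemannianKorn.H1Field n M,
        α * RiemannianKorn.normH1 u ^ 2 - (μ + α) * RiemannianKorn.normL2 u ^ 2
          ≤ RiemannianKorn.formK u u ∧
        (2 ≤ n →
          α * RiemannianKorn.normH1 u ^ 2 - (μ + α) * RiemannianKorn.normL2 u ^ 2
            ≤ RiemannianKorn.formC u u)) ∧
    -- no Killing and conformal Killing fields for negative definite Ricci tensor
    (RiemannianKorn.RicciNegDef n M →
      (∀ u : (∀ x : M, TangentSpace (𝓡 n) x), RiemannianKorn.IsKilling u → u = 0) ∧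
      (2 ≤ n → ∀ u : (∀ x : M, TangentSpace (𝓡 n) x),
        RiemannianKorn.IsConformalKilling u → u = 0)) :=
  ⟨RiemannianKorn.isCoerciveForm_formK, RiemannianKorn.isCoerciveForm_formC,
    RiemannianKorn.bddAbove_norm_ricci, RiemannianKorn.formC_self_le_formK_self,
    fun _ hμ _ _ hα u => ⟨RiemannianKorn.le_formK u hμ hα,
      fun hn => RiemannianKorn.le_formC u hn hμ hα⟩,
    fun hR => ⟨fun _ hu => hu.eq_zero hR, fun hn _ hu => hu.eq_zero hn hR⟩⟩
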